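/- **Setup.** Let $x_{k+1}=Ax_k+Bu_k+w_k$ with $A\in\mathbb R^{n\times n}$, $B\in\mathbb R^{n\times m}$, where $w_k$ is i.i.d. zero-mean Gaussian with covariance $R_w$, and $x_0$ is zero-mean Gaussian with covariance $R_0$ and independent of $(w_k)$. Fix a horizon $N$, weights $Q_0,Q_1\succeq 0$, $Q_2\succ0$, and a threshold $\epsilon\in\mathbb R$. The loop uses a shared network: the scheduler outputs $\gamma_k\in\{0,1\}$ (1 if $x_k$ is to be sent), $n_k\in\{0,1\}$ indicates exogenous traffic, $\delta_k=\mathcal R(\gamma_k,n_k)\in\{0,1\}$ is the (possibly randomized) outcome of contention resolution, $\bar\delta_k=1-\delta_k$, and the controller receives $y_k=\delta_kx_k$ and $\delta_k$. The traffic indicator $n_k$ may depend on the past $\gamma_0,\dots,\gamma_{k-1},\delta_0,\dots,\delta_{k-1}$ and on exogenous randomness; the exogenous randomness of traffic and contention resolution is independent of $(x_0,w_0,w_1,\dots)$. Let $\mathbb I_k$ be the information $\{y_0,\dots,y_k,\delta_0,\dots,\delta_k,u_0,\dots,u_{k-1}\}$. An admissible control law is $u_k=g_k(\mathbb I_k)$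 with $g_k$ measurable, and its cost is $$J(g)=\mathbb E\Big[x_N^TQ_0x_N+\sum_{s=0}^{N-1}(x_s^TQ_1x_s+u_s^TQ_2u_s)\Big]\in[0,\infty].$$ Dual predictor architecture: put $\hat x_{0|\tau_{-1}}=\mathbb E[x_0]=0$ and $\hat x_{k|\tau_{k-1}}=A\hat x_{k-1|k-1}+Bu_{k-1}$ for $k\ge1$. The scheduler sets $\gamma_k=1$ if $|x_k-\hat x_{k|\tau_{k-1}}|^2>\epsilon$ and $\gamma_k=0$ otherwise (it replicates the observer and knows the applied controls). The observer is $\hat x_{k|k}=\bar\delta_k\hat x_{k|\tau_{k-1}}+\delta_kx_k$. The controller is $u_k=-L_k\hat x_{k|k}$, where $S_N=Q_0$ and, for $k<N$, $$L_k=(Q_2+B^TS_{k+1}B)^{-1}B^TS_{k+1}A,\qquad S_k=Q_1+A^TS_{k+1}A-A^TS_{k+1}B(Q_2+B^TS_{k+1}B)^{-1}B^TS_{k+1}A.$$ **Theorem.** With this plant, network, scheduler and observer, the following hold. (i) For every admissible control law, in particular for $u_k=-L_k\hat x_{k|k}$, and every $k\le N$: $\hat x_{k|k}$ is $\mathbb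 I_k$-measurable, the error $x_k-\hat x_{k|k}$ is square integrable, and $\hat x_{k|k}$ minimizes $\mathbb E|x_k-z|^2$ over all $\mathbb I_k$-measurable $z$. If the controls $u_0,\dots,u_{N-1}$ are integrable (as they are for $u_k=-L_k\hat x_{k|k}$), then $\hat x_{k|k}=\mathbb E[x_k\mid\mathbb I_k]$ almost surely. (ii) The control has no dual effect of any order $r\ge2$: for every admissible control law with integrable controls, all $k\le N$ and all components $i$, with $M^r_{k,i}=(x_{k,i}-\mathbb E[x_{k,i}\mid\mathbb I_k])^r$ and with the superscript $0$ denoting the system with $u\equiv0$ (whose signals depend only on the primitive random variables), $M^r_{k,i}$ is integrable and almost surely $$\mathbb E[M^r_{k,i}\mid\mathbb I_k]=\mathbb E[M^r_{k,i}\mid\mathbb I^0_k]=\mathbb E[M^{r,0}_{k,i}\mid\mathbb I^0_k].$$ (iii) The Certainty Equivalence Principle holds: an optimal admissible law exists, and every optimal admissible law satisfies, almost surely for $k<N$, $u_k=\varphi_k(\mathbb E[x_k\mid\mathbb I_k])$, where $\varphi$ is a deterministic optimal feedback, i.e. one that minimizes the cost-to-go of the noise-free plant with full state information from every time and state. The feedback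 $x\mapsto-L_kx$ is such a deterministic optimal feedback, and the law $u_k=-L_k\hat x_{k|k}$ is admissible and minimizes $J$ over all admissible control laws. (iv) The cost of the architecture with $u_k=-L_k\hat x_{k|k}$ is finite and equals $$J_{\mathrm{DP}}=\hat x_0^TS_0\hat x_0+\operatorname{tr}\{S_0P_0\}+\sum_{k=0}^{N-1}\mathbb E\Big[\operatorname{tr}\{S_{k+1}R_w+L_k^T(Q_2+B^TS_{k+1}B)L_kP_{k|k}\}\Big],$$ where $\hat x_0=\mathbb E[x_0]$ $(=0)$, $P_0=R_0$, and $P_{k|k}=\mathbb E[(x_k-\hat x_{k|k})(x_k-\hat x_{k|k})^T\mid\mathbb I_k]$ is the error covariance of the estimate at the observer. -/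

import Mathlib

open MeasureTheory ProbabilityTheory Matrix
open scoped ENNReal

namespace DualPredictor

/-- Real Euclidean space of dimension `d`. -/
abbrev E (d : ℕ) : Type := EuclideanSpace ℝ (Fin d)

/-- Matrix acting on Euclidean vectors. -/
noncomputable def act {p q : ℕ} (M : Matrix (Fin p) (Fin q) ℝ) (x : E q) : E p :=
  WithLp.toLp 2 (M *ᵥ x.ofLp)

/-- The quadratic form `xᵀ Q x`. -/
def quad {d : ℕ} (Q : Matrix (Fin d) (Fin d) ℝ) (x : E d) : ℝ :=
  x.ofLp ⬝ᵥ (Q *ᵥ x.ofLp)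

/-- The deterministic data of the control loop: state dimension `n`, control dimension `m`;
`V` is the space of the exogenous randomness that drives the network traffic, `C` is the space
of the randomness used by the contention resolution at one time instant. -/
structure Loop (n m : ℕ) (V C : Type*) where
  /-- plant matrix -/
  A : Matrix (Fin n) (Fin n) ℝ
  /-- input matrix -/
  B : Matrix (Fin n) (Fin m) ℝ
  /-- process noise covariance -/
  Rw : Matrix (Fin n) (Fin n) ℝ
  /-- initial state covariance -/
  R0 : Matrix (Fin n) (Fin n) ℝ
  /-- terminal state weight -/
  Q0 : Matrix (Fin n) (Fin n) ℝ
  /-- running state weight -/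
  Q1 : Matrix (Fin n) (Fin n) ℝ
  /-- control weight -/
  Q2 : Matrix (Fin m) (Fin m) ℝ
  /-- horizon -/
  N : ℕ
  /-- scheduler threshold -/
  eps : ℝ
  /-- The traffic indicator `n_k`: it may depend on the exogenous randomness, and also on the past
  channel access requests `γ_0, …, γ_{k-1}` and MAC outputs `δ_0, …, δ_{k-1}` of this loop. -/
  traffic : (k : ℕ) → V → (Fin k → Bool) → (Fin k → Bool) → Bool
  /-- The MAC channel response: `δ_k = R(γ_k, n_k)`, possibly randomized. -/
  mac : Bool → Bool → C → Bool

/-- The values of the signals of the loop at one time instant. -/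
structure Step (n m : ℕ) where
  /-- state `x_k` -/
  x : E n
  /-- scheduler output `γ_k` -/
  gam : Bool
  /-- traffic indicator `n_k` -/
  traf : Bool
  /-- MAC output `δ_k` -/
  del : Bool
  /-- measurement `y_k` -/
  y : E n
  /-- control `u_k` -/
  u : E m

/-- The values of the information pattern of the controller at time `k`:
`(y_0, …, y_k)`, `(δ_0, …, δ_k)`, `(u_0, …, u_{k-1})`. -/
abbrev Info (n m k : ℕ) : Type :=
  (Fin (k + 1) → E n) × (Fin (k + 1) → Bool) × (Fin k → E m)

/-- A control law: the control at time `k` is a function of the information at time `k`. -/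
abbrev Law (n m : ℕ) : Type := (k : ℕ) → Info n m k → E m

/-- Admissible control laws are the measurable ones. -/
def Law.Admissible {n m : ℕ} (g : Law n m) : Prop := ∀ k, Measurable (g k)

namespace Loop

variable {n m : ℕ} {V C : Type*} (P : Loop n m V C)

/-- The prediction of `x_k` from `y_0, …, y_{k-1}`, `δ_0, …, δ_{k-1}`, `u_0, …, u_{k-1}`. It is the
prior mean `0` of the initial state at time `0`, and `A x̂_{k|k} + B u_k` at time `k + 1`, where
`x̂_{k|k}` is `x_k` if `δ_k = 1`, and the previous prediction otherwise. -/
noncomputable def predict :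
    (k : ℕ) → (Fin k → E n) → (Fin k → Bool) → (Fin k → E m) → E n
  | 0, _, _, _ => 0
  | k + 1, y, d, u =>
      act P.A (if d (Fin.last k) then y (Fin.last k)
        else predict k (Fin.init y) (Fin.init d) (Fin.init u))
      + act P.B (u (Fin.last k))

/-- The observer: the estimate `x̂_{k|k}` as a function of the information at time `k`. -/
noncomputable def observe (k : ℕ) (I : Info n m k) : E n :=
  if I.2.1 (Fin.last k) then I.1 (Fin.last k)
  else P.predict k (Fin.init I.1) (Fin.init I.2.1) I.2.2

/-- The innovation-based scheduler: transmit iff `|x - x̂|² > ε`. -/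
noncomputable def schedule (x xhat : E n) : Bool := decide (P.eps < ‖x - xhat‖ ^ 2)

/-- The plant: the state at time `k` from the initial state, the noise, and the past. -/
noncomputable def plantState (x0 : E n) (w : ℕ → E n) : (k : ℕ) → (Fin k → Step n m) → E n
  | 0, _ => x0
  | k + 1, past =>
      act P.A (past (Fin.last k)).x + act P.B (past (Fin.last k)).u + w k

/-- The signals of the closed loop under the control law `g`, for given values of the initial state
`x0`, the process noise `w`, the exogenous traffic randomness `v` and the contention resolution
randomness `c`. The scheduler replicates the observer, and knows the applied controls. -/
noncomputable def traj (g : Law n m) (x0 : E n) (w : ℕ → E n) (v : V) (c : ℕ → C) (k : ℕ) :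
    Step n m :=
  let past : Fin k → Step n m := fun i => traj g x0 w v c i
  let x := P.plantState x0 w k past
  let gam := P.schedule x
    (P.predict k (fun i => (past i).y) (fun i => (past i).del) (fun i => (past i).u))
  let traf := P.traffic k v (fun i => (past i).gam) (fun i => (past i).del)
  let del := P.mac gam traf (c k)
  let y : E n := if del then x else 0
  let u := g k (Fin.snoc (fun i => (past i).y) y, Fin.snoc (fun i => (past i).del) del,
    fun i => (past i).u)
  { x := x, gam := gam, traf := traf, del := del, y := y, u := u }
termination_by k
decreasing_by exact i.isLt

/-- One backward step of the Riccati recursion. -/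
noncomputable def riccatiStep (S : Matrix (Fin n) (Fin n) ℝ) : Matrix (Fin n) (Fin n) ℝ :=
  P.Q1 + P.Aᵀ * S * P.A
    - P.Aᵀ * S * P.B * (P.Q2 + P.Bᵀ * S * P.B)⁻¹ * (P.Bᵀ * S * P.A)

/-- `S_N = Q_0`, and `S_k` (for `k < N`) is obtained from `S_{k+1}` by a Riccati step. -/
noncomputable def S (k : ℕ) : Matrix (Fin n) (Fin n) ℝ := P.riccatiStep^[P.N - k] P.Q0

/-- The gain `L_k = (Q_2 + Bᵀ S_{k+1} B)⁻¹ Bᵀ S_{k+1} A`. -/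
noncomputable def L (k : ℕ) : Matrix (Fin m) (Fin n) ℝ :=
  (P.Q2 + P.Bᵀ * P.S (k + 1) * P.B)⁻¹ * (P.Bᵀ * P.S (k + 1) * P.A)

/-- The controller of the architecture: `u_k = - L_k x̂_{k|k}`. -/
noncomputable def controller : Law n m := fun k I => - act (P.L k) (P.observe k I)

/-- The cost, from time `k` (with `j` steps to go) and state `x`, of the state feedback `ψ` for the
noise-free plant `x_{k+1} = A x_k + B u_k` with full state information. -/
noncomputable def detCost (ψ : ℕ → E n → E m) : (j k : ℕ) → E n → ℝ
  | 0, _, x => quad P.Q0 x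
  | j + 1, k, x => quad P.Q1 x + quad P.Q2 (ψ k x)
      + detCost ψ j (k + 1) (act P.A x + act P.B (ψ k x))

/-- The feedback `φ` is a deterministic optimal controller: it minimizes the cost-to-go of the
noise-free plant from every time and every state. -/
def IsDetOptimal (φ : ℕ → E n → E m) : Prop :=
  ∀ k ≤ P.N, ∀ (x : E n) (ψ : ℕ → E n → E m),
    P.detCost φ (P.N - k) k x ≤ P.detCost ψ (P.N - k) k x

end Loop

/-- The primitive random variables: initial state, process noise, exogenous traffic randomness,
contention resolution randomness. -/
structure Primitives (Ω : Type*) (n : ℕ) (V C : Type*) where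
  /-- initial state -/
  x0 : Ω → E n
  /-- process noise -/
  w : ℕ → Ω → E n
  /-- exogenous traffic randomness -/
  v : Ω → V
  /-- contention resolution randomness -/
  c : ℕ → Ω → C

/-- The standing assumptions: `Q_0, Q_1 ≥ 0`, `Q_2 > 0`; the noise is i.i.d. zero-mean Gaussian with
covariance `R_w`, the initial state is zero-mean Gaussian with covariance `R_0` and independent
of the noise; the randomness of traffic and contention resolution is independent of the initial
state and the noise of the plant. -/
structure Standing {Ω V C : Type*} [MeasurableSpace Ω] [MeasurableSpace V] [MeasurableSpace C]
    {n m : ℕ} (P : Loop n m V C) (Z : Primitives Ω n V C) (μ : Measure Ω) : Prop where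
  Rw_posSemidef : P.Rw.PosSemidef
  R0_posSemidef : P.R0.PosSemidef
  Q0_posSemidef : P.Q0.PosSemidef
  Q1_posSemidef : P.Q1.PosSemidef
  Q2_posDef : P.Q2.PosDef
  measurable_traffic : ∀ k a b, Measurable fun v => P.traffic k v a b
  measurable_mac : ∀ a b, Measurable (P.mac a b)
  measurable_x0 : Measurable Z.x0
  measurable_w : ∀ k, Measurable (Z.w k)
  measurable_v : Measurable Z.v
  measurable_c : ∀ k, Measurable (Z.c k)
  law_x0 : μ.map Z.x0 = multivariateGaussian 0 P.R0
  law_w : ∀ k, μ.map (Z.w k) = multivariateGaussian 0 P.Rw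
  indep_w : iIndepFun Z.w μ
  indep_x0_w : IndepFun Z.x0 (fun ω k => Z.w k ω) μ
  indep_plant_network :
    IndepFun (fun ω => (Z.x0 ω, fun k => Z.w k ω)) (fun ω => (Z.v ω, fun k => Z.c k ω)) μ

section Random

variable {Ω V C : Type*} {n m : ℕ} (P : Loop n m V C) (Z : Primitives Ω n V C) (g : Law n m)

/-- The signals of the closed loop at time `k`, as random variables. -/
noncomputable def signals (k : ℕ) (ω : Ω) : Step n m :=
  P.traj g (Z.x0 ω) (fun j => Z.w j ω) (Z.v ω) (fun j => Z.c j ω) k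

/-- The state `x_k`. -/
noncomputable def state (k : ℕ) (ω : Ω) : E n := (signals P Z g k ω).x

/-- The control `u_k`. -/
noncomputable def ctrl (k : ℕ) (ω : Ω) : E m := (signals P Z g k ω).u

/-- The information of the controller at time `k`, as a random variable. -/
noncomputable def info (k : ℕ) (ω : Ω) : Info n m k :=
  (fun i => (signals P Z g i ω).y, fun i => (signals P Z g i ω).del,
    fun i => (signals P Z g i ω).u)

/-- The sigma-algebra generated by the information of the controller at time `k`. -/
@[reducible]
noncomputable def infoSigma (k : ℕ) : MeasurableSpace Ω :=
  MeasurableSpace.comap (info P Z g k) inferInstance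

/-- The estimate `x̂_{k|k}` computed by the observer. -/
noncomputable def estimate (k : ℕ) (ω : Ω) : E n := P.observe k (info P Z g k ω)

/-- The realized value of the quadratic cost. -/
noncomputable def realizedCost (ω : Ω) : ℝ :=
  quad P.Q0 (state P Z g P.N ω)
    + ∑ s ∈ Finset.range P.N, (quad P.Q1 (state P Z g s ω) + quad P.Q2 (ctrl P Z g s ω))

/-- The law that applies no control; the resulting state is the uncontrolled process. -/
def zeroLaw (n m : ℕ) : Law n m := fun _ _ => 0

variable [MeasurableSpace Ω] (μ : Measure Ω)

/-- The LQG cost `J`, the expectation of the (nonnegative) realized cost; it may be `∞`. -/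
noncomputable def cost : ℝ≥0∞ := ∫⁻ ω, ENNReal.ofReal (realizedCost P Z g ω) ∂μ

/-- `g` minimizes the LQG cost over all admissible control laws. -/
def IsOptimal : Prop :=
  g.Admissible ∧ ∀ g' : Law n m, g'.Admissible → cost P Z g μ ≤ cost P Z g' μ

/-- The conditional expectation `E[x_k | I_k]`. -/
noncomputable def condMean (k : ℕ) : Ω → E n := μ[state P Z g k | infoSigma P Z g k]

/-- The controls applied within the horizon are integrable. -/
def IntegrableControls : Prop := ∀ k < P.N, Integrable (ctrl P Z g k) μ

/-- `M_{k,i}^r = (x_{k,i} - E[x_{k,i} | I_k])^r`. -/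
noncomputable def centralPower (r k : ℕ) (i : Fin n) (ω : Ω) : ℝ :=
  (state P Z g k ω i - (μ[fun ω' => state P Z g k ω' i | infoSigma P Z g k]) ω) ^ r

/-- The error covariance `P_{k|k}` of the estimate of the observer, conditional on `I_k`. -/
noncomputable def errorCov (k : ℕ) (ω : Ω) : Matrix (Fin n) (Fin n) ℝ :=
  Matrix.of fun i j =>
    (μ[fun ω' => (state P Z g k ω' i - estimate P Z g k ω' i)
        * (state P Z g k ω' j - estimate P Z g k ω' j) | infoSigma P Z g k]) ω

/-- The control has no dual effect of order `r`: for all admissible control laws (with integrable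
controls, so that conditional means make sense), the conditional central moments of order `r` of
the components of the state are those obtained from the information of the uncontrolled process,
that is, from primitive random variables only; they are the same whatever the control law. -/
def NoDualEffect (r : ℕ) : Prop :=
  ∀ g : Law n m, g.Admissible → IntegrableControls P Z g μ → ∀ k ≤ P.N, ∀ i : Fin n,
    Integrable (centralPower P Z g μ r k i) μ ∧
    μ[centralPower P Z g μ r k i | infoSigma P Z g k]
      =ᵐ[μ] μ[centralPower P Z g μ r k i | infoSigma P Z (zeroLaw n m) k] ∧
    μ[centralPower P Z g μ r k i | infoSigma P Z g k]
      =ᵐ[μ] μ[centralPower P Z (zeroLaw n m) μ r k i | infoSigma P Z (zeroLaw n m) k]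

/-- The Certainty Equivalence Principle: an optimal control law exists, and every optimal control
law has the form of the deterministic optimal controller, with the state replaced by its
conditional mean given the information of the controller. -/
def CertaintyEquivalence : Prop :=
  ∃ φ : ℕ → E n → E m, P.IsDetOptimal φ ∧ (∃ g, IsOptimal P Z g μ) ∧
    ∀ g, IsOptimal P Z g μ → ∀ k < P.N,
      ctrl P Z g k =ᵐ[μ] fun ω => φ k (condMean P Z g μ k ω)

end Random

end DualPredictor

set_option linter.unusedSectionVars false

/-! In error coordinates the control cancels: the next innovation is `A` times the current error
plus fresh noise, and the scheduler, the traffic and the contention resolution read only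
innovations, earlier requests and outcomes, and exogenous randomness. Hence innovations, requests,
MAC outputs and errors agree sample by sample for all control laws (`network_signals_congr`). The
controller's information amounts to the MAC outputs and the transmitted innovations, so its
sigma-algebra is also the same for all admissible laws (`infoSigma_congr`). This gives the absence
of a dual effect.

Optimality of the estimate is a sign symmetry. `SignFree μ a e` says that `(a, e)` and `(a, -e)`
have the same law. It holds at time 0 because the initial state is centred Gaussian and independent
of the network. It survives the scheduler, which sees only the norm of the innovation
(`SignFree.censor`), and the plant, which applies an odd map and adds independent symmetric noise
(`SignFree.add_indepFun`). The induction conditions on `netHist`, which contains all the exogenous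
randomness, so that the MAC output is a deterministic function of history and innovation. The
outcome, `Standing.signFree_err`, shows that silence of the channel reveals nothing about the sign
of the error: its conditional mean is zero, and by the parallelogram law no other measurable
estimate does better, even if the state itself is not integrable.

For the cost, completing the square along the Riccati recursion (`Loop.quad_step`) leaves cross
terms that vanish by independence of the noise and by sign symmetry of the error. The expected cost
is therefore a control-free part plus weighted mean squares of `u_k + L_k x̂_{k|k}`
(`Standing.integral_realizedCost`). The architecture makes these squares zero, and definiteness of
the weights forces every optimal law to do so almost surely. Only square integrable controls matter,
since `Q2` is positive definite and other laws have infinite cost. -/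

namespace DualPredictor

/-! ### Continuity and measurability of matrix actions and quadratic forms. -/

section Act

variable {p q : ℕ}

/-- `act M` as a continuous linear map. -/
noncomputable def actCLM (M : Matrix (Fin p) (Fin q) ℝ) : E q →L[ℝ] E p :=
  LinearMap.toContinuousLinearMap (Matrix.toLpLin 2 2 M)

theorem act_eq_actCLM (M : Matrix (Fin p) (Fin q) ℝ) (x : E q) : act M x = actCLM M x := rfl

theorem act_add (M : Matrix (Fin p) (Fin q) ℝ) (x y : E q) : act M (x + y) = act M x + act M y := by
  simp only [act_eq_actCLM, map_add]

theorem act_sub (M : Matrix (Fin p) (Fin q) ℝ) (x y : E q) : act M (x - y) = act M x - act M y := by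
  simp only [act_eq_actCLM, map_sub]

theorem act_neg (M : Matrix (Fin p) (Fin q) ℝ) (x : E q) : act M (-x) = -act M x := by
  simp only [act_eq_actCLM, map_neg]

@[fun_prop]
theorem continuous_act (M : Matrix (Fin p) (Fin q) ℝ) : Continuous (act M) :=
  (actCLM M).continuous

@[fun_prop]
theorem measurable_act (M : Matrix (Fin p) (Fin q) ℝ) : Measurable (act M) :=
  (continuous_act M).measurable

theorem memLp_act {Ω : Type*} [MeasurableSpace Ω] {μ : Measure Ω} {r : ℝ≥0∞}
    (M : Matrix (Fin p) (Fin q) ℝ) {f : Ω → E q} (hf : MemLp f r μ) :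
    MemLp (fun ω => act M (f ω)) r μ :=
  (actCLM M).comp_memLp' hf

@[fun_prop]
theorem continuous_quad (Q : Matrix (Fin p) (Fin p) ℝ) : Continuous (quad Q) := by
  unfold quad
  simp only [dotProduct, mulVec]
  fun_prop

end Act

/-- The function `Fin.snoc` is jointly measurable. -/
theorem measurable_finSnoc {α X : Type*} [MeasurableSpace α] [MeasurableSpace X] {k : ℕ}
    {f : α → Fin k → X} {f' : α → X} (hf : Measurable f) (hf' : Measurable f') :
    Measurable (fun a => (Fin.snoc (f a) (f' a) : Fin (k + 1) → X)) := by
  refine measurable_pi_iff.2 fun i => ?_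
  induction i using Fin.lastCases with
  | last => simpa using hf'
  | cast i => simpa using (measurable_pi_iff.1 hf i)

theorem measurable_finInit {X : Type*} [MeasurableSpace X] {k : ℕ} :
    Measurable (fun f : Fin (k + 1) → X => (Fin.init f : Fin k → X)) :=
  measurable_pi_iff.2 fun i => measurable_pi_apply i.castSucc

/-! ### Control-free recursion of innovations and errors. -/

section Recursion

variable {Ω V C : Type*} {n m : ℕ} (P : Loop n m V C) (Z : Primitives Ω n V C) (g : Law n m)

/-- The prediction `x̂_{k|τ_{k-1}}`. -/
noncomputable def prediction (k : ℕ) (ω : Ω) : E n :=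
  P.predict k (fun i => (signals P Z g i ω).y) (fun i => (signals P Z g i ω).del)
    (fun i => (signals P Z g i ω).u)

/-- The innovation `x_k - x̂_{k|τ_{k-1}}`. -/
noncomputable def innov (k : ℕ) (ω : Ω) : E n := state P Z g k ω - prediction P Z g k ω

/-- The MAC output `δ_k`. -/
noncomputable def del (k : ℕ) (ω : Ω) : Bool := (signals P Z g k ω).del

/-- The scheduler output `γ_k`. -/
noncomputable def gam (k : ℕ) (ω : Ω) : Bool := (signals P Z g k ω).gam

/-- The estimation error `x_k - x̂_{k|k}`. -/
noncomputable def err (k : ℕ) (ω : Ω) : E n := state P Z g k ω - estimate P Z g k ω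

/-- The transmitted innovation `δ_k (x_k - x̂_{k|τ_{k-1}})`. -/
noncomputable def sentInnov (k : ℕ) (ω : Ω) : E n :=
  if del P Z g k ω then innov P Z g k ω else 0

theorem state_zero (ω : Ω) : state P Z g 0 ω = Z.x0 ω := by
  rw [state, signals, Loop.traj]; rfl

theorem state_succ (k : ℕ) (ω : Ω) :
    state P Z g (k + 1) ω = act P.A (state P Z g k ω) + act P.B (ctrl P Z g k ω) + Z.w k ω := by
  rw [state, signals, Loop.traj]; rfl

theorem gam_eq (k : ℕ) (ω : Ω) :
    gam P Z g k ω = decide (P.eps < ‖innov P Z g k ω‖ ^ 2) := by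
  rw [gam, innov, state, signals, Loop.traj]; rfl

theorem del_eq (k : ℕ) (ω : Ω) :
    del P Z g k ω = P.mac (gam P Z g k ω)
      (P.traffic k (Z.v ω) (fun i => gam P Z g i ω) (fun i => del P Z g i ω)) (Z.c k ω) := by
  rw [del, gam, signals, Loop.traj]; rfl

theorem y_eq (k : ℕ) (ω : Ω) :
    (signals P Z g k ω).y = if del P Z g k ω then state P Z g k ω else 0 := by
  rw [del, state, signals, Loop.traj]

theorem ctrl_eq (k : ℕ) (ω : Ω) : ctrl P Z g k ω = g k (info P Z g k ω) := by
  rw [ctrl, signals, Loop.traj]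
  simp only
  congr 1
  refine Prod.ext ?_ (Prod.ext ?_ rfl)
  · funext i
    induction i using Fin.lastCases with
    | last => simp only [Fin.snoc_last, info, Fin.val_last]; rw [signals, Loop.traj]
    | cast i => simp only [Fin.snoc_castSucc, info, Fin.val_castSucc]; rfl
  · funext i
    induction i using Fin.lastCases with
    | last => simp only [Fin.snoc_last, info, Fin.val_last]; rw [signals, Loop.traj]
    | cast i => simp only [Fin.snoc_castSucc, info, Fin.val_castSucc]; rfl

theorem estimate_eq (k : ℕ) (ω : Ω) :
    estimate P Z g k ω = if del P Z g k ω then state P Z g k ω else prediction P Z g k ω := by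
  rw [estimate, Loop.observe]
  have hd : (info P Z g k ω).2.1 (Fin.last k) = del P Z g k ω := rfl
  have hy : (info P Z g k ω).1 (Fin.last k) = (signals P Z g k ω).y := rfl
  rw [hd, hy, y_eq]
  cases del P Z g k ω <;> rfl

theorem prediction_zero (ω : Ω) : prediction P Z g 0 ω = 0 := rfl

theorem prediction_succ (k : ℕ) (ω : Ω) :
    prediction P Z g (k + 1) ω
      = act P.A (estimate P Z g k ω) + act P.B (ctrl P Z g k ω) := rfl

theorem err_eq (k : ℕ) (ω : Ω) :
    err P Z g k ω = if del P Z g k ω then 0 else innov P Z g k ω := by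
  rw [err, estimate_eq, innov]
  cases del P Z g k ω <;> simp

theorem innov_zero (ω : Ω) : innov P Z g 0 ω = Z.x0 ω := by
  rw [innov, state_zero, prediction_zero, sub_zero]

/-- The predictor and the plant receive the same term `B u_k`, which cancels. Everything about the
absence of a dual effect rests on this. -/
theorem innov_succ (k : ℕ) (ω : Ω) :
    innov P Z g (k + 1) ω = act P.A (err P Z g k ω) + Z.w k ω := by
  rw [innov, state_succ, prediction_succ, err, act_sub]
  abel

theorem norm_err_le (k : ℕ) (ω : Ω) : ‖err P Z g k ω‖ ≤ ‖innov P Z g k ω‖ := by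
  rw [err_eq]
  cases del P Z g k ω <;> simp

/-- The innovations, the scheduler and the MAC outputs do not depend on the control law. -/
theorem network_signals_congr (g' : Law n m) (k : ℕ) (ω : Ω) :
    innov P Z g k ω = innov P Z g' k ω ∧ gam P Z g k ω = gam P Z g' k ω ∧
      del P Z g k ω = del P Z g' k ω := by
  induction k using Nat.strong_induction_on with
  | _ k ih =>
    have h1 : innov P Z g k ω = innov P Z g' k ω := by
      cases k with
      | zero => rw [innov_zero, innov_zero]
      | succ k =>
        obtain ⟨ha, -, hc⟩ := ih k (Nat.lt_succ_self k)
        rw [innov_succ, innov_succ, err_eq, err_eq, ha, hc]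
    have h2 : gam P Z g k ω = gam P Z g' k ω := by rw [gam_eq, gam_eq, h1]
    refine ⟨h1, h2, ?_⟩
    rw [del_eq, del_eq, h2]
    congr 2
    · funext i; exact (ih i i.2).2.1
    · funext i; exact (ih i i.2).2.2

theorem err_congr (g' : Law n m) (k : ℕ) (ω : Ω) : err P Z g k ω = err P Z g' k ω := by
  obtain ⟨ha, -, hc⟩ := network_signals_congr P Z g g' k ω
  rw [err_eq, err_eq, ha, hc]

theorem sentInnov_congr (g' : Law n m) (k : ℕ) (ω : Ω) :
    sentInnov P Z g k ω = sentInnov P Z g' k ω := by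
  obtain ⟨ha, -, hc⟩ := network_signals_congr P Z g g' k ω
  rw [sentInnov, sentInnov, ha, hc]

/-- Lets the measurement be rebuilt from the prediction, the MAC output and the transmitted
innovation. -/
theorem estimate_eq_prediction_add (k : ℕ) (ω : Ω) :
    estimate P Z g k ω = prediction P Z g k ω + sentInnov P Z g k ω := by
  rw [estimate_eq, sentInnov, innov]
  cases del P Z g k ω <;> simp

end Recursion

/-! ### Information of the controller versus transmitted innovations. -/

section Measurability

variable {V C : Type*} {n m : ℕ} (P : Loop n m V C)

theorem measurable_predict (k : ℕ) :
    Measurable fun a : (Fin k → E n) × (Fin k → Bool) × (Fin k → E m) =>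
      P.predict k a.1 a.2.1 a.2.2 := by
  induction k with
  | zero => exact measurable_const
  | succ k ih =>
    simp only [Loop.predict]
    refine ((measurable_act _).comp (Measurable.ite ?_ ?_ ?_)).add
      ((measurable_act _).comp (by fun_prop))
    · exact measurableSet_eq_fun (by fun_prop) measurable_const
    · fun_prop
    · exact ih.comp ((measurable_finInit.comp measurable_fst).prodMk
        ((measurable_finInit.comp measurable_snd.fst).prodMk
          (measurable_finInit.comp measurable_snd.snd)))

theorem measurable_observe (k : ℕ) : Measurable (P.observe (n := n) (m := m) k) := by
  unfold Loop.observe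
  refine Measurable.ite ?_ ?_ ?_
  · exact measurableSet_eq_fun (by fun_prop) measurable_const
  · fun_prop
  · exact (measurable_predict P k).comp ((measurable_finInit.comp measurable_fst).prodMk
        ((measurable_finInit.comp measurable_snd.fst).prodMk measurable_snd.snd))

theorem controller_admissible : P.controller.Admissible := fun k =>
  ((measurable_act _).comp (measurable_observe P k)).neg

theorem zeroLaw_admissible (n m : ℕ) : (zeroLaw n m).Admissible := fun _ => measurable_const

variable {Ω : Type*} (Z : Primitives Ω n V C) {g : Law n m}

theorem measurable_prediction_of {mΩ : MeasurableSpace Ω} {k : ℕ}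
    (hy : ∀ i < k, Measurable fun ω => (signals P Z g i ω).y)
    (hd : ∀ i < k, Measurable (del P Z g i))
    (hu : ∀ i < k, Measurable (ctrl P Z g i)) : Measurable (prediction P Z g k) :=
  (measurable_predict P k).comp
    ((measurable_pi_iff.2 fun j : Fin k => hy j j.2).prodMk
      ((measurable_pi_iff.2 fun j : Fin k => hd j j.2).prodMk
        (measurable_pi_iff.2 fun j : Fin k => hu j j.2)))

theorem measurable_sentInnov_of {mΩ : MeasurableSpace Ω} {k : ℕ}
    (hy : Measurable fun ω => (signals P Z g k ω).y) (hd : Measurable (del P Z g k))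
    (hp : Measurable (prediction P Z g k)) : Measurable (sentInnov P Z g k) := by
  have : sentInnov P Z g k = fun ω => if del P Z g k ω = true
      then (signals P Z g k ω).y - prediction P Z g k ω else 0 := by
    funext ω
    rw [y_eq, sentInnov, innov]
    cases del P Z g k ω <;> rfl
  rw [this]
  exact Measurable.ite (measurableSet_eq_fun hd measurable_const) (hy.sub hp) measurable_const

/-- If the transmitted innovations and the MAC outputs up to time `k` are measurable, then so is
the information of the controller. -/
theorem measurable_info_of_sentInnov {mΩ : MeasurableSpace Ω} (hg : g.Admissible) (k : ℕ)
    (hd : ∀ i ≤ k, Measurable (del P Z g i)) (hs : ∀ i ≤ k, Measurable (sentInnov P Z g i)) :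
    Measurable (info P Z g k) := by
  -- Measurements and controls are treated jointly: the prediction needs earlier measurements and
  -- controls, and the control at `i` needs the measurement at `i` itself.
  have key : ∀ i ≤ k, Measurable (fun ω => (signals P Z g i ω).y) ∧
      Measurable (fun ω => (signals P Z g i ω).u) := by
    intro i
    induction i using Nat.strong_induction_on with
    | _ i ih =>
      intro hi
      have hp : Measurable (prediction P Z g i) :=
        measurable_prediction_of P Z (fun j hj => (ih j hj (by omega)).1)
          (fun j hj => hd j (by omega)) fun j hj => (ih j hj (by omega)).2
      have hy : Measurable (fun ω => (signals P Z g i ω).y) := by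
        have : (fun ω => (signals P Z g i ω).y) = fun ω => if del P Z g i ω = true
            then prediction P Z g i ω + sentInnov P Z g i ω else 0 := by
          funext ω
          rw [y_eq, ← estimate_eq_prediction_add, estimate_eq]
          cases del P Z g i ω <;> rfl
        rw [this]
        exact Measurable.ite (measurableSet_eq_fun (hd i hi) measurable_const)
          (hp.add (hs i hi)) measurable_const
      refine ⟨hy, ?_⟩
      have hu : (fun ω => (signals P Z g i ω).u) = fun ω => g i (info P Z g i ω) :=
        funext (ctrl_eq P Z g i)
      rw [hu]
      refine (hg i).comp ((measurable_pi_iff.2 fun j => ?_).prodMk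
        ((measurable_pi_iff.2 fun j : Fin (i + 1) => hd j (by omega)).prodMk
          (measurable_pi_iff.2 fun j : Fin i => (ih j j.2 (by omega)).2)))
      rcases Nat.lt_succ_iff_lt_or_eq.1 j.2 with hj | hj
      · exact (ih j hj (by omega)).1
      · rw [hj]; exact hy
  exact (measurable_pi_iff.2 fun j : Fin (k + 1) => (key j (by omega)).1).prodMk
    ((measurable_pi_iff.2 fun j : Fin (k + 1) => hd j (by omega)).prodMk
      (measurable_pi_iff.2 fun j : Fin k => (key j (by omega)).2))

variable (g) in
theorem measurable_del_infoSigma {i k : ℕ} (hi : i ≤ k) :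
    Measurable[infoSigma P Z g k] (del P Z g i) :=
  ((measurable_pi_apply (⟨i, by omega⟩ : Fin (k + 1))).comp measurable_snd.fst).comp
    (comap_measurable (info P Z g k))

-- Converse of `measurable_info_of_sentInnov`: the controller can compute its own predictions and
-- subtract them from what it receives.
variable (g) in
theorem measurable_sentInnov_infoSigma {i k : ℕ} (hi : i ≤ k) :
    Measurable[infoSigma P Z g k] (sentInnov P Z g i) := by
  have hinfo : Measurable[infoSigma P Z g k] (info P Z g k) := comap_measurable _
  have hy : ∀ j ≤ k, Measurable[infoSigma P Z g k] (fun ω => (signals P Z g j ω).y) := fun j hj =>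
    ((measurable_pi_apply (⟨j, by omega⟩ : Fin (k + 1))).comp measurable_fst).comp hinfo
  have hu : ∀ j < k, Measurable[infoSigma P Z g k] (fun ω => (signals P Z g j ω).u) := fun j hj =>
    ((measurable_pi_apply (⟨j, hj⟩ : Fin k)).comp measurable_snd.snd).comp hinfo
  exact measurable_sentInnov_of P Z (hy i hi)
    (measurable_del_infoSigma P Z g hi)
    (measurable_prediction_of P Z (fun j hj => hy j (by omega))
      (fun j hj => measurable_del_infoSigma P Z g (by omega)) fun j hj => hu j (by omega))

/-- The information of the controller does not depend on the control law. -/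
theorem infoSigma_congr {g' : Law n m} (hg : g.Admissible) (hg' : g'.Admissible) (k : ℕ) :
    infoSigma P Z g k = infoSigma P Z g' k := by
  -- The data that generate the information under `a` coincide with those under `b`, and the latter
  -- are `b`-measurable. Exchanging the laws gives the other inclusion.
  have key : ∀ {a b : Law n m}, a.Admissible → infoSigma P Z a k ≤ infoSigma P Z b k := by
    intro a b ha
    refine Measurable.comap_le (measurable_info_of_sentInnov P Z ha k (fun i hi => ?_)
      fun i hi => ?_)
    · rw [show del P Z a i = del P Z b i from
        funext fun ω => (network_signals_congr P Z a b i ω).2.2]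
      exact measurable_del_infoSigma P Z b hi
    · rw [show sentInnov P Z a i = sentInnov P Z b i from funext (sentInnov_congr P Z a b i)]
      exact measurable_sentInnov_infoSigma P Z b hi
  exact le_antisymm (key hg) (key hg')

variable (g) in
theorem measurable_estimate_infoSigma (k : ℕ) :
    Measurable[infoSigma P Z g k] (estimate P Z g k) :=
  (measurable_observe P k).comp (comap_measurable _)

theorem measurable_ctrl_infoSigma (hg : g.Admissible) (k : ℕ) :
    Measurable[infoSigma P Z g k] (ctrl P Z g k) := by
  rw [show ctrl P Z g k = fun ω => g k (info P Z g k ω) from funext (ctrl_eq P Z g k)]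
  exact (hg k).comp (comap_measurable _)

end Measurability

end DualPredictor

namespace DualPredictor

/-! ### Calculus of sign symmetry. -/

section Symmetry

variable {Ω X Y W F : Type*} [MeasurableSpace Ω] [MeasurableSpace X] [MeasurableSpace Y]
  [MeasurableSpace W] {μ : Measure Ω}

theorem indepFun_prodMk_left [IsFiniteMeasure μ] {a : Ω → X} {b : Ω → Y} {c : Ω → W}
    (ha : Measurable a) (hb : Measurable b) (hc : Measurable c)
    (h : IndepFun a (fun ω => (b ω, c ω)) μ) (h' : IndepFun b c μ) :
    IndepFun (fun ω => (a ω, b ω)) c μ := by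
  have hab : IndepFun a b μ := h.comp measurable_id measurable_fst
  rw [indepFun_iff_map_prod_eq_prod_map_map (by fun_prop) (by fun_prop)] at h h' hab ⊢
  rw [hab]
  have : (fun ω => ((a ω, b ω), c ω)) = MeasurableEquiv.prodAssoc.symm ∘
      fun ω => (a ω, (b ω, c ω)) := rfl
  rw [this, ← Measure.map_map (by fun_prop) (by fun_prop), h, h', ← Measure.prodAssoc_prod,
    Measure.map_map (by fun_prop) (by fun_prop)]
  simp

/-- The characteristic function of a centred Gaussian is even. -/
theorem map_neg_multivariateGaussian {d : ℕ} {S : Matrix (Fin d) (Fin d) ℝ}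
    (hS : S.PosSemidef) :
    (multivariateGaussian 0 S).map (fun x => -x) = multivariateGaussian 0 S := by
  have : IsProbabilityMeasure ((multivariateGaussian (0 : E d) S).map (fun x => -x)) :=
    Measure.isProbabilityMeasure_map (by fun_prop)
  refine Measure.ext_of_charFun ?_
  ext t
  have h1 : (fun x : E d => -x) = fun x => (-1 : ℝ) • x := by funext x; simp
  rw [h1, charFun_map_smul, charFun_multivariateGaussian hS, charFun_multivariateGaussian hS]
  simp [mulVec_neg]

variable [NormedAddCommGroup F] [InnerProductSpace ℝ F] [MeasurableSpace F] [BorelSpace F]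
  [SecondCountableTopology F]

theorem map_prodMk_neg_of_indepFun [IsFiniteMeasure μ] {a : Ω → X} {e : Ω → F}
    (ha : Measurable a) (he : Measurable e) (h : IndepFun a e μ)
    (hs : (μ.map e).map (fun x => -x) = μ.map e) :
    μ.map (fun ω => (a ω, e ω)) = μ.map (fun ω => (a ω, -e ω)) := by
  have h' : IndepFun a (fun ω => -e ω) μ := h.comp measurable_id measurable_neg
  rw [indepFun_iff_map_prod_eq_prod_map_map (by fun_prop) (by fun_prop)] at h h'
  rw [h, h', ← hs, Measure.map_map (by fun_prop) (by fun_prop)]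
  rfl

/-- An observation `a` carries no information on the sign of `e`. -/
def SignFree (μ : Measure Ω) (a : Ω → X) (e : Ω → F) : Prop :=
  μ.map (fun ω => (a ω, e ω)) = μ.map (fun ω => (a ω, -e ω))

/-- The integral equals its own negative. No integrability is required, as both sides are Bochner
integrals with their default value otherwise. -/
theorem SignFree.integral_inner_eq_zero {a e : Ω → F} (h : SignFree μ a e) (ha : Measurable a)
    (he : Measurable e) : ∫ ω, inner ℝ (a ω) (e ω) ∂μ = 0 := by
  have hf : AEStronglyMeasurable (fun z : F × F => inner ℝ z.1 z.2)
      (μ.map fun ω => (a ω, e ω)) := by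
    exact (Measurable.inner measurable_fst measurable_snd).aestronglyMeasurable
  have h1 := integral_map (ha.prodMk he).aemeasurable hf
  have h2 := integral_map (ha.prodMk he.neg).aemeasurable (h ▸ hf)
  simp only at h1 h2
  have h3 : ∫ ω, inner ℝ (a ω) (e ω) ∂μ = ∫ ω, inner ℝ (a ω) (-e ω) ∂μ := by
    rw [← h1, h]; exact h2
  simp only [inner_neg_right, integral_neg] at h3
  linarith

/-- Applied with indicators for `a`, this identifies the conditional mean of `e`. -/
theorem SignFree.integral_smul_eq_zero {a : Ω → ℝ} {e : Ω → F} (h : SignFree μ a e)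
    (ha : Measurable a) (he : Measurable e) : ∫ ω, a ω • e ω ∂μ = 0 := by
  have hf : AEStronglyMeasurable (fun z : ℝ × F => z.1 • z.2)
      (μ.map fun ω => (a ω, e ω)) :=
    (Measurable.smul measurable_fst measurable_snd).aestronglyMeasurable
  have h1 := integral_map (ha.prodMk he).aemeasurable hf
  have h2 := integral_map (ha.prodMk he.neg).aemeasurable (h ▸ hf)
  simp only at h1 h2
  have h3 : ∫ ω, a ω • e ω ∂μ = ∫ ω, a ω • (-e ω) ∂μ := by
    rw [← h1, h]; exact h2
  simp only [smul_neg, integral_neg] at h3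
  have h4 : (2 : ℝ) • ∫ ω, a ω • e ω ∂μ = 0 := by
    rw [two_smul]
    nth_rw 1 [h3]
    exact neg_add_cancel _
  exact (smul_eq_zero.1 h4).resolve_left two_ne_zero

/-- By independence `w` can be integrated out first, leaving a kernel `K` of `(a, e)`. Since `T` is
odd and `w` symmetric, flipping the sign of the sum turns `K (a, e)` into `K (a, -e)`, and the
hypothesis on `(a, e)` applies. -/
theorem SignFree.add_indepFun [IsFiniteMeasure μ] {a : Ω → X} {e w : Ω → F} {T : F → F}
    (h : SignFree μ a e) (ha : Measurable a) (he : Measurable e) (hw : Measurable w)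
    (hT : Measurable T) (hodd : ∀ x, T (-x) = -T x) (hind : IndepFun (fun ω => (a ω, e ω)) w μ)
    (hs : (μ.map w).map (fun x => -x) = μ.map w) :
    SignFree μ a (fun ω => T (e ω) + w ω) := by
  have hmap := (indepFun_iff_map_prod_eq_prod_map_map (by fun_prop) (by fun_prop)).1 hind
  refine Measure.ext_of_lintegral _ fun f hf => ?_
  rw [lintegral_map hf (by fun_prop), lintegral_map hf (by fun_prop)]
  let K : X × F → ℝ≥0∞ := fun z => ∫⁻ x, f (z.1, T z.2 + x) ∂(μ.map w)
  have hadd : Measurable fun z : (X × F) × F => f (z.1.1, T z.1.2 + z.2) := by fun_prop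
  have hsub : Measurable fun z : (X × F) × F => f (z.1.1, -(T z.1.2 + z.2)) := by fun_prop
  have hK : Measurable K := hadd.lintegral_prod_right'
  have e1 : ∫⁻ ω, f (a ω, T (e ω) + w ω) ∂μ = ∫⁻ ω, K (a ω, e ω) ∂μ := by
    have h1 := lintegral_map hadd ((ha.prodMk he).prodMk hw) (μ := μ)
    rw [hmap, lintegral_prod _ hadd.aemeasurable, lintegral_map hK (ha.prodMk he)] at h1
    exact h1.symm
  have e3 : ∀ z : X × F, ∫⁻ x, f (z.1, -(T z.2 + x)) ∂(μ.map w) = K (z.1, -z.2) := by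
    intro z
    rw [← hs, lintegral_map (by fun_prop) (by fun_prop)]
    simp only [K, hodd, neg_add, neg_neg]
  have e2 : ∫⁻ ω, f (a ω, -(T (e ω) + w ω)) ∂μ = ∫⁻ ω, K (a ω, -e ω) ∂μ := by
    have h1 := lintegral_map hsub ((ha.prodMk he).prodMk hw) (μ := μ)
    rw [hmap, lintegral_prod _ hsub.aemeasurable] at h1
    simp only [e3] at h1
    rw [lintegral_map (f := fun z : X × F => K (z.1, -z.2)) (by fun_prop) (ha.prodMk he)] at h1
    exact h1.symm
  rw [e1, e2, ← lintegral_map hK (ha.prodMk he), h, lintegral_map hK (by fun_prop)]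

/-- Censoring a variable by an even test preserves the absence of information on the sign. -/
theorem SignFree.censor {a : Ω → X} {e : Ω → F} {b : Ω → Y} {D : X × F → Bool}
    {φ : X × F → Y} {ψ : X × F → Y}
    (h : SignFree μ a e) (ha : Measurable a) (he : Measurable e) (hb : Measurable b)
    (hD : Measurable D) (hφ : Measurable φ) (hψ : Measurable ψ)
    (hDn : ∀ x y, D (x, -y) = D (x, y)) (hψn : ∀ x y, ψ (x, -y) = ψ (x, y))
    (hb_eq : ∀ ω, b ω = if D (a ω, e ω) then φ (a ω, e ω) else ψ (a ω, e ω)) :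
    SignFree μ b (fun ω => if D (a ω, e ω) then 0 else e ω) := by
  have hDs : MeasurableSet {z : X × F | D z = true} := measurableSet_eq_fun hD measurable_const
  have hc : Measurable fun ω => if D (a ω, e ω) = true then 0 else e ω :=
    Measurable.ite ((ha.prodMk he) hDs) measurable_const he
  refine Measure.ext_of_lintegral _ fun f hf => ?_
  rw [lintegral_map hf (by exact hb.prodMk hc), lintegral_map hf (by exact hb.prodMk hc.neg)]
  -- Where `D` holds the censored variable is zero, so `G` is unaffected by the sign flip. Elsewhere
  -- `b` is even in `e`, so the flip acts only on the second argument of `K`.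
  let G : X × F → ℝ≥0∞ := fun z => if D z = true then f (φ z, 0) else 0
  let K : X × F → ℝ≥0∞ := fun z => if D z = true then 0 else f (ψ z, z.2)
  have hG : Measurable G := Measurable.ite hDs (by fun_prop) measurable_const
  have hK : Measurable K := Measurable.ite hDs measurable_const (by fun_prop)
  have e1 : ∀ ω, f (b ω, if D (a ω, e ω) = true then 0 else e ω)
      = G (a ω, e ω) + K (a ω, e ω) := by
    intro ω
    simp only [G, K, hb_eq]
    cases D (a ω, e ω) <;> simp
  have e2 : ∀ ω, f (b ω, -if D (a ω, e ω) = true then 0 else e ω)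
      = G (a ω, e ω) + K (a ω, -e ω) := by
    intro ω
    simp only [G, K, hb_eq, hDn, hψn]
    cases D (a ω, e ω) <;> simp
  simp only [e1, e2]
  rw [lintegral_add_left (by fun_prop), lintegral_add_left (by fun_prop),
    ← lintegral_map hK (ha.prodMk he), h, lintegral_map hK (by fun_prop)]

theorem SignFree.comp {a : Ω → X} {e : Ω → F} {φ : X → Y} (h : SignFree μ a e)
    (ha : Measurable a) (he : Measurable e) (hφ : Measurable φ) : SignFree μ (φ ∘ a) e := by
  have hΨ : Measurable fun z : X × F => (φ z.1, z.2) := by fun_prop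
  have h' := congrArg (Measure.map fun z : X × F => (φ z.1, z.2)) h
  rw [Measure.map_map hΨ (by fun_prop), Measure.map_map hΨ (by fun_prop)] at h'
  exact h'

/-- Averaging over the signs `e + a` and `-e + a` gives `‖e‖² + ‖a‖²` by the parallelogram law.
Working in `ℝ≥0∞` allows `a` without second moments. -/
theorem SignFree.lintegral_norm_sq_le {a e : Ω → F} (h : SignFree μ a e) (ha : Measurable a)
    (he : Measurable e) :
    ∫⁻ ω, ENNReal.ofReal (‖e ω‖ ^ 2) ∂μ ≤ ∫⁻ ω, ENNReal.ofReal (‖e ω + a ω‖ ^ 2) ∂μ := by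
  have hf : Measurable (fun z : F × F => ENNReal.ofReal (‖z.2 + z.1‖ ^ 2)) := by fun_prop
  have h1 := lintegral_map (μ := μ) hf (ha.prodMk he)
  have h2 := lintegral_map (μ := μ) hf (ha.prodMk he.neg)
  have h3 : ∫⁻ ω, ENNReal.ofReal (‖e ω + a ω‖ ^ 2) ∂μ
      = ∫⁻ ω, ENNReal.ofReal (‖-e ω + a ω‖ ^ 2) ∂μ := by
    rw [h] at h1
    exact h1.symm.trans h2
  have h4 : 2 * ∫⁻ ω, ENNReal.ofReal (‖e ω‖ ^ 2) ∂μ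
      ≤ 2 * ∫⁻ ω, ENNReal.ofReal (‖e ω + a ω‖ ^ 2) ∂μ := by
    rw [two_mul (∫⁻ ω, ENNReal.ofReal (‖e ω + a ω‖ ^ 2) ∂μ)]
    nth_rw 2 [h3]
    rw [← lintegral_add_left (by fun_prop), ← lintegral_const_mul _ (by fun_prop)]
    refine lintegral_mono fun ω => ?_
    rw [← ENNReal.ofReal_add (by positivity) (by positivity),
      show (2 : ℝ≥0∞) = ENNReal.ofReal 2 by simp, ← ENNReal.ofReal_mul (by norm_num)]
    refine ENNReal.ofReal_le_ofReal ?_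
    have := parallelogram_law_with_norm ℝ (a ω) (e ω)
    rw [add_comm (e ω), neg_add_eq_sub]
    nlinarith [sq_nonneg ‖a ω‖]
  exact (ENNReal.mul_le_mul_iff_right (by norm_num) (by norm_num)).1 h4

end Symmetry

/-! ### Sign symmetry along the network. -/

section Network

variable {V C : Type*} [MeasurableSpace V] [MeasurableSpace C] {n m : ℕ} {P : Loop n m V C}

theorem measurable_mac (h : ∀ a b, Measurable (P.mac a b)) :
    Measurable fun z : (Bool × Bool) × C => P.mac z.1.1 z.1.2 z.2 :=
  measurable_from_prod_countable_right fun z => h z.1 z.2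

theorem measurable_traffic {k : ℕ} (h : ∀ a b, Measurable fun v => P.traffic k v a b) :
    Measurable fun z : ((Fin k → Bool) × (Fin k → Bool)) × V => P.traffic k z.2 z.1.1 z.1.2 :=
  measurable_from_prod_countable_right fun z => h z.1 z.2

theorem measurable_schedule (P : Loop n m V C) :
    Measurable fun p : E n => decide (P.eps < ‖p‖ ^ 2) :=
  measurable_to_bool (by
    have : (fun p : E n => decide (P.eps < ‖p‖ ^ 2)) ⁻¹' {true} = {p | P.eps < ‖p‖ ^ 2} := by
      ext; simp
    rw [this]
    exact measurableSet_lt measurable_const (by fun_prop))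

variable {Ω : Type*} {Z : Primitives Ω n V C} {g : Law n m}

/-- The network signals up to time `k` are measurable functions of the initial state, the noise
before time `k` and the exogenous randomness. -/
theorem measurable_network_signals {mΩ : MeasurableSpace Ω}
    (ht : ∀ k a b, Measurable fun v => P.traffic k v a b) (hmac : ∀ a b, Measurable (P.mac a b))
    {k : ℕ} (h0 : Measurable Z.x0) (hw : ∀ j < k, Measurable (Z.w j)) (hv : Measurable Z.v)
    (hc : ∀ j, Measurable (Z.c j)) (g : Law n m) (i : ℕ) (hi : i ≤ k) :
    Measurable (innov P Z g i) ∧ Measurable (gam P Z g i) ∧ Measurable (del P Z g i) := by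
  induction i using Nat.strong_induction_on with
  | _ i ih =>
    have h1 : Measurable (innov P Z g i) := by
      cases i with
      | zero => rw [show innov P Z g 0 = Z.x0 from funext (innov_zero P Z g)]; exact h0
      | succ i =>
        obtain ⟨ha, -, hd⟩ := ih i (Nat.lt_succ_self i) (by omega)
        rw [show innov P Z g (i + 1) = fun ω => act P.A (err P Z g i ω) + Z.w i ω from
          funext (innov_succ P Z g i)]
        simp only [err_eq]
        exact ((measurable_act _).comp (Measurable.ite
          (measurableSet_eq_fun hd measurable_const) measurable_const ha)).add (hw i (by omega))
    have h2 : Measurable (gam P Z g i) := by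
      rw [show gam P Z g i = fun ω => decide (P.eps < ‖innov P Z g i ω‖ ^ 2) from
        funext (gam_eq P Z g i)]
      exact (measurable_schedule P).comp h1
    refine ⟨h1, h2, ?_⟩
    rw [show del P Z g i = _ from funext (del_eq P Z g i)]
    have h3 : Measurable fun ω => P.traffic i (Z.v ω) (fun j : Fin i => gam P Z g j ω)
        (fun j => del P Z g j ω) :=
      (measurable_traffic (ht i)).comp (((measurable_pi_iff.2 fun j : Fin i =>
        (ih j j.2 (by omega)).2.1).prodMk (measurable_pi_iff.2 fun j : Fin i =>
        (ih j j.2 (by omega)).2.2)).prodMk hv)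
    exact (measurable_mac hmac).comp ((h2.prodMk h3).prodMk (hc i))

theorem measurable_sentInnov {mΩ : MeasurableSpace Ω} {i : ℕ} (hp : Measurable (innov P Z g i))
    (hd : Measurable (del P Z g i)) : Measurable (sentInnov P Z g i) :=
  Measurable.ite (measurableSet_eq_fun hd measurable_const) hp measurable_const

theorem measurable_err {mΩ : MeasurableSpace Ω} {i : ℕ} (hp : Measurable (innov P Z g i))
    (hd : Measurable (del P Z g i)) : Measurable (err P Z g i) := by
  rw [show err P Z g i = _ from funext (err_eq P Z g i)]
  exact Measurable.ite (measurableSet_eq_fun hd measurable_const) measurable_const hp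

theorem measurable_info {mΩ : MeasurableSpace Ω}
    (ht : ∀ k a b, Measurable fun v => P.traffic k v a b) (hmac : ∀ a b, Measurable (P.mac a b))
    {k : ℕ} (h0 : Measurable Z.x0) (hw : ∀ j < k, Measurable (Z.w j)) (hv : Measurable Z.v)
    (hc : ∀ j, Measurable (Z.c j)) (hg : g.Admissible) : Measurable (info P Z g k) := by
  have key := measurable_network_signals ht hmac h0 hw hv hc g
  exact measurable_info_of_sentInnov P Z hg k (fun i hi => (key i hi).2.2)
    fun i hi => measurable_sentInnov (key i hi).1 (key i hi).2.2

theorem measurable_ctrl {mΩ : MeasurableSpace Ω}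
    (ht : ∀ k a b, Measurable fun v => P.traffic k v a b) (hmac : ∀ a b, Measurable (P.mac a b))
    {k : ℕ} (h0 : Measurable Z.x0) (hw : ∀ j < k, Measurable (Z.w j)) (hv : Measurable Z.v)
    (hc : ∀ j, Measurable (Z.c j)) (hg : g.Admissible) : Measurable (ctrl P Z g k) := by
  rw [show ctrl P Z g k = fun ω => g k (info P Z g k ω) from funext (ctrl_eq P Z g k)]
  exact (hg k).comp (measurable_info ht hmac h0 hw hv hc hg)

/-- The sigma-algebra is left variable so that it can be the one generated by `past Z k`, which
excludes the noise from time `k` on. -/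
theorem measurable_state {mΩ : MeasurableSpace Ω}
    (ht : ∀ k a b, Measurable fun v => P.traffic k v a b) (hmac : ∀ a b, Measurable (P.mac a b))
    {k : ℕ} (h0 : Measurable Z.x0) (hw : ∀ j < k, Measurable (Z.w j)) (hv : Measurable Z.v)
    (hc : ∀ j, Measurable (Z.c j)) (hg : g.Admissible) : Measurable (state P Z g k) := by
  have key := measurable_network_signals ht hmac h0 hw hv hc g k le_rfl
  have : state P Z g k = fun ω => err P Z g k ω + estimate P Z g k ω := by
    funext ω; simp [err]
  rw [this]
  exact (measurable_err key.1 key.2.2).add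
    ((measurable_observe P k).comp (measurable_info ht hmac h0 hw hv hc hg))

/-- The primitive random variables that are relevant up to time `k`. -/
def past (Z : Primitives Ω n V C) (k : ℕ) (ω : Ω) :
    (V × (ℕ → C)) × E n × (Fin k → E n) :=
  ((Z.v ω, fun j => Z.c j ω), Z.x0 ω, fun j => Z.w j ω)

variable [MeasurableSpace Ω] {μ : Measure Ω}

theorem Standing.measurable_past (h : Standing P Z μ) (k : ℕ) : Measurable (past Z k) :=
  (h.measurable_v.prodMk (measurable_pi_iff.2 h.measurable_c)).prodMk
    (h.measurable_x0.prodMk (measurable_pi_iff.2 fun j : Fin k => h.measurable_w j))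

/-- Built from the inside out with `indepFun_prodMk_left`: first the earlier noise, then the initial
state, then the network randomness is joined. -/
theorem Standing.indepFun_past [IsProbabilityMeasure μ] (h : Standing P Z μ) (k : ℕ) :
    IndepFun (past Z k) (Z.w k) μ := by
  have hv := h.measurable_v
  have hc := h.measurable_c
  have hx := h.measurable_x0
  have hw := h.measurable_w
  have hwk : Measurable fun ω => fun j : Fin k => Z.w j ω :=
    measurable_pi_iff.2 fun j : Fin k => hw j
  have h1 : IndepFun (fun ω => fun j : Fin k => Z.w j ω) (Z.w k) μ := by
    have hφ : Measurable fun (f : Finset.range k → E n) (j : Fin k) =>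
        f ⟨j, Finset.mem_range.2 j.2⟩ := by fun_prop
    have hψ : Measurable fun f : ({k} : Finset ℕ) → E n =>
        f ⟨k, Finset.mem_singleton_self k⟩ := by fun_prop
    exact (h.indep_w.indepFun_finset (Finset.range k) {k} (by simp) hw).comp hφ hψ
  have h2 : IndepFun Z.x0 (fun ω => ((fun j : Fin k => Z.w j ω), Z.w k ω)) μ :=
    h.indep_x0_w.comp (φ := id)
      (ψ := fun f : ℕ → E n => ((fun j : Fin k => f j), f k)) measurable_id
      ((measurable_pi_iff.2 fun j => measurable_pi_apply _).prodMk (measurable_pi_apply _))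
  have h3 := indepFun_prodMk_left hx hwk (hw k) h2 h1
  have h4 : IndepFun (fun ω => (Z.v ω, fun j => Z.c j ω))
      (fun ω => ((Z.x0 ω, fun j : Fin k => Z.w j ω), Z.w k ω)) μ :=
    h.indep_plant_network.symm.comp (φ := id)
      (ψ := fun f : E n × (ℕ → E n) => ((f.1, fun j : Fin k => f.2 j), f.2 k)) measurable_id
      ((measurable_fst.prodMk (measurable_pi_iff.2 fun j =>
        (measurable_pi_apply _).comp measurable_snd)).prodMk
          ((measurable_pi_apply _).comp measurable_snd))
  exact indepFun_prodMk_left (hv.prodMk (measurable_pi_iff.2 hc)) (hx.prodMk hwk) (hw k) h4 h3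

theorem Standing.indepFun_of_measurable_past [IsProbabilityMeasure μ] (h : Standing P Z μ)
    {X : Type*} [MeasurableSpace X] {k : ℕ} {a : Ω → X}
    (ha : Measurable[MeasurableSpace.comap (past Z k) inferInstance] a) :
    IndepFun a (Z.w k) μ :=
  indep_of_indep_of_le_left (h.indepFun_past k) ha.comap_le

theorem Standing.map_neg_w [IsProbabilityMeasure μ] (h : Standing P Z μ) (k : ℕ) :
    (μ.map (Z.w k)).map (fun x => -x) = μ.map (Z.w k) := by
  rw [h.law_w k, map_neg_multivariateGaussian h.Rw_posSemidef]

section PastMeasurability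

variable (Z) (k : ℕ)

theorem measurable_x0_past :
    Measurable[MeasurableSpace.comap (past Z k) inferInstance] Z.x0 :=
  measurable_snd.fst.comp (comap_measurable (past Z k))

theorem measurable_w_past (j : ℕ) (hj : j < k) :
    Measurable[MeasurableSpace.comap (past Z k) inferInstance] (Z.w j) :=
  ((measurable_pi_apply (⟨j, hj⟩ : Fin k)).comp measurable_snd.snd).comp
    (comap_measurable (past Z k))

theorem measurable_v_past :
    Measurable[MeasurableSpace.comap (past Z k) inferInstance] Z.v :=
  measurable_fst.fst.comp (comap_measurable (past Z k))

theorem measurable_c_past (j : ℕ) :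
    Measurable[MeasurableSpace.comap (past Z k) inferInstance] (Z.c j) :=
  ((measurable_pi_apply j).comp measurable_fst.snd).comp (comap_measurable (past Z k))

end PastMeasurability

/-- The history of the network before time `k`, together with the exogenous randomness. -/
abbrev NetHist (n : ℕ) (V C : Type*) (k : ℕ) : Type _ :=
  (Fin k → Bool) × (Fin k → Bool) × (Fin k → E n) × V × (ℕ → C)

/-- The history of the network before time `k`, as a random variable. -/
noncomputable def netHist (P : Loop n m V C) (Z : Primitives Ω n V C) (g : Law n m) (k : ℕ)
    (ω : Ω) : NetHist n V C k :=
  (fun i => gam P Z g i ω, fun i => del P Z g i ω, fun i => sentInnov P Z g i ω, Z.v ω,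
    fun j => Z.c j ω)

/-- The MAC output as a function of the history of the network and the innovation. -/
noncomputable def Loop.macOutput (P : Loop n m V C) (k : ℕ) (z : NetHist n V C k × E n) : Bool :=
  P.mac (decide (P.eps < ‖z.2‖ ^ 2)) (P.traffic k z.1.2.2.2.1 z.1.1 z.1.2.1) (z.1.2.2.2.2 k)

/-- The history of the network at the next time instant, from the current history, the innovation,
the MAC output and the transmitted innovation. -/
noncomputable def Loop.nextHist (P : Loop n m V C) (k : ℕ) (h : NetHist n V C k) (p : E n)
    (d : Bool) (s : E n) : NetHist n V C (k + 1) :=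
  (Fin.snoc h.1 (decide (P.eps < ‖p‖ ^ 2)), Fin.snoc h.2.1 d, Fin.snoc h.2.2.1 s, h.2.2.2)

theorem netHist_succ (k : ℕ) (ω : Ω) :
    netHist P Z g (k + 1) ω = P.nextHist k (netHist P Z g k ω) (innov P Z g k ω)
      (del P Z g k ω) (sentInnov P Z g k ω) := by
  have key : ∀ {X : Type} (f : ℕ → X), (fun i : Fin (k + 1) => f i)
      = Fin.snoc (fun i : Fin k => f i) (f k) := by
    intro X f
    funext i
    induction i using Fin.lastCases with
    | last => simp
    | cast i => simp
  refine Prod.ext ?_ (Prod.ext ?_ (Prod.ext ?_ rfl))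
  · exact (key fun i => gam P Z g i ω).trans (by rw [gam_eq]; rfl)
  · exact key fun i => del P Z g i ω
  · exact key fun i => sentInnov P Z g i ω

theorem del_eq_macOutput (k : ℕ) (ω : Ω) :
    del P Z g k ω = P.macOutput k (netHist P Z g k ω, innov P Z g k ω) := by
  rw [del_eq, gam_eq]; rfl

/-- The scheduler tests only the norm of the innovation, so censoring is even. -/
theorem macOutput_neg (k : ℕ) (hist : NetHist n V C k) (p : E n) :
    P.macOutput k (hist, -p) = P.macOutput k (hist, p) := by
  simp only [Loop.macOutput, norm_neg]

theorem measurable_macOutput (ht : ∀ k a b, Measurable fun v => P.traffic k v a b)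
    (hmac : ∀ a b, Measurable (P.mac a b)) (k : ℕ) : Measurable (P.macOutput k) := by
  refine (measurable_mac hmac).comp ((Measurable.prodMk ?_ ?_).prodMk ?_)
  · exact (measurable_schedule P).comp measurable_snd
  · exact (measurable_traffic (ht k)).comp (by fun_prop : Measurable fun z : NetHist n V C k × E n =>
      ((z.1.1, z.1.2.1), z.1.2.2.2.1))
  · fun_prop

theorem measurable_nextHist (P : Loop n m V C) (k : ℕ) :
    Measurable fun z : (NetHist n V C k × E n) × Bool × E n =>
      P.nextHist k z.1.1 z.1.2 z.2.1 z.2.2 :=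
  (measurable_finSnoc (by fun_prop) ((measurable_schedule P).comp (by fun_prop))).prodMk
    ((measurable_finSnoc (by fun_prop) (by fun_prop)).prodMk
      ((measurable_finSnoc (by fun_prop) (by fun_prop)).prodMk (by fun_prop)))

theorem measurable_netHist {mΩ : MeasurableSpace Ω}
    (ht : ∀ k a b, Measurable fun v => P.traffic k v a b) (hmac : ∀ a b, Measurable (P.mac a b))
    {k : ℕ} (h0 : Measurable Z.x0) (hw : ∀ j < k, Measurable (Z.w j)) (hv : Measurable Z.v)
    (hc : ∀ j, Measurable (Z.c j)) {i : ℕ} (hi : i ≤ k + 1) :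
    Measurable (netHist P Z g i) := by
  have key := measurable_network_signals ht hmac h0 hw hv hc g
  exact (measurable_pi_iff.2 fun j : Fin i => (key j (by omega)).2.1).prodMk
    ((measurable_pi_iff.2 fun j : Fin i => (key j (by omega)).2.2).prodMk
      ((measurable_pi_iff.2 fun j : Fin i => measurable_sentInnov (key j (by omega)).1
        (key j (by omega)).2.2).prodMk (hv.prodMk (measurable_pi_iff.2 hc))))

/-- If the network history does not reveal the sign of the innovation, then the history at the next
time instant does not reveal the sign of the estimation error. -/
theorem Standing.signFree_err_of_innov (h : Standing P Z μ) {k : ℕ}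
    (hs : SignFree μ (netHist P Z g k) (innov P Z g k)) :
    SignFree μ (netHist P Z g (k + 1)) (err P Z g k) := by
  have hsig := measurable_network_signals h.measurable_traffic h.measurable_mac
    h.measurable_x0 (fun j (_ : j < k) => h.measurable_w j) h.measurable_v h.measurable_c g k le_rfl
  have hH : ∀ i ≤ k + 1, Measurable (netHist P Z g i) := fun i hi =>
    measurable_netHist h.measurable_traffic h.measurable_mac
      h.measurable_x0 (fun j (_ : j < k) => h.measurable_w j) h.measurable_v h.measurable_c hi
  -- The two branches of the next history: the innovation is recorded if sent, and replaced by 0 if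
  -- not. Only the second has to be even in the innovation, because in the first the error is zero.
  have h1 : Measurable fun z : NetHist n V C k × E n => P.nextHist k z.1 z.2 true z.2 :=
    (measurable_nextHist P k).comp (g := fun z : (NetHist n V C k × E n) × Bool × E n =>
      P.nextHist k z.1.1 z.1.2 z.2.1 z.2.2) (f := fun z => (z, true, z.2)) (by fun_prop)
  have h2 : Measurable fun z : NetHist n V C k × E n => P.nextHist k z.1 z.2 false 0 :=
    (measurable_nextHist P k).comp (g := fun z : (NetHist n V C k × E n) × Bool × E n =>
      P.nextHist k z.1.1 z.1.2 z.2.1 z.2.2) (f := fun z => (z, false, (0 : E n))) (by fun_prop)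
  have key := hs.censor (b := netHist P Z g (k + 1)) (hH k (by omega)) hsig.1 (hH _ le_rfl)
    (measurable_macOutput h.measurable_traffic h.measurable_mac k) h1 h2 (macOutput_neg k)
    (fun x y => by simp only [Loop.nextHist, norm_neg]) (fun ω => by
      rw [← del_eq_macOutput, netHist_succ, sentInnov]
      cases del P Z g k ω <;> rfl)
  simp only [← del_eq_macOutput, ← err_eq] at key
  exact key

/-- The history at `k + 1` and the error at `k` are functions of `past Z k`, hence jointly
independent of the symmetric noise `w k` that drives the next innovation. -/
theorem Standing.signFree_innov_succ [IsProbabilityMeasure μ] (h : Standing P Z μ) {k : ℕ}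
    (hs : SignFree μ (netHist P Z g (k + 1)) (err P Z g k)) :
    SignFree μ (netHist P Z g (k + 1)) (innov P Z g (k + 1)) := by
  have hsigp := measurable_network_signals h.measurable_traffic h.measurable_mac
    (measurable_x0_past Z k) (measurable_w_past Z k) (measurable_v_past Z k)
    (measurable_c_past Z k) g k le_rfl
  have hHp := measurable_netHist (g := g) h.measurable_traffic h.measurable_mac
    (measurable_x0_past Z k) (measurable_w_past Z k) (measurable_v_past Z k)
    (measurable_c_past Z k) le_rfl
  have hle : MeasurableSpace.comap (past Z k) inferInstance ≤ ‹MeasurableSpace Ω› :=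
    (h.measurable_past k).comap_le
  have hind : IndepFun (fun ω => (netHist P Z g (k + 1) ω, err P Z g k ω)) (Z.w k) μ :=
    h.indepFun_of_measurable_past (hHp.prodMk (measurable_err hsigp.1 hsigp.2.2))
  have hH : Measurable (netHist P Z g (k + 1)) := hHp.mono hle le_rfl
  have he : Measurable (err P Z g k) := (measurable_err hsigp.1 hsigp.2.2).mono hle le_rfl
  rw [show innov P Z g (k + 1) = _ from funext (innov_succ P Z g k)]
  exact hs.add_indepFun hH he (h.measurable_w k) (measurable_act P.A) (act_neg P.A) hind
    (h.map_neg_w k)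

variable (g) in
theorem Standing.signFree_innov [IsProbabilityMeasure μ] (h : Standing P Z μ) (k : ℕ) :
    SignFree μ (netHist P Z g k) (innov P Z g k) := by
  induction k with
  | zero =>
    rw [show innov P Z g 0 = Z.x0 from funext (innov_zero P Z g)]
    have hind : IndepFun (fun ω => (Z.v ω, fun j => Z.c j ω)) Z.x0 μ :=
      h.indep_plant_network.symm.comp measurable_id measurable_fst
    -- At time 0 the history consists of the exogenous randomness alone.
    have hind' : IndepFun (netHist P Z g 0) Z.x0 μ := by
      have hφ : Measurable (fun z : V × (ℕ → C) =>
        ((Fin.elim0, Fin.elim0, Fin.elim0, z) : NetHist n V C 0)) := by fun_prop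
      have := hind.comp hφ measurable_id
      convert! this using 1
      funext ω
      refine Prod.ext ?_ (Prod.ext ?_ (Prod.ext ?_ rfl)) <;> exact Subsingleton.elim _ _
    refine map_prodMk_neg_of_indepFun ?_ h.measurable_x0 hind' ?_
    · exact measurable_netHist (k := 0) h.measurable_traffic h.measurable_mac h.measurable_x0
        (fun j _ => h.measurable_w j) h.measurable_v h.measurable_c (by omega)
    · rw [h.law_x0, map_neg_multivariateGaussian h.R0_posSemidef]
  | succ k ih => exact h.signFree_innov_succ (h.signFree_err_of_innov ih)

/-- The information of the controller does not reveal the sign of the estimation error. -/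
theorem Standing.signFree_err [IsProbabilityMeasure μ] (h : Standing P Z μ) (hg : g.Admissible)
    (k : ℕ) {X : Type*} [MeasurableSpace X] [StandardBorelSpace X] [Nonempty X] {a : Ω → X}
    (ha : Measurable[infoSigma P Z g k] a) : SignFree μ a (err P Z g k) := by
  have hsig := measurable_network_signals h.measurable_traffic h.measurable_mac
    h.measurable_x0 (fun j (_ : j < k) => h.measurable_w j) h.measurable_v h.measurable_c g k le_rfl
  have hH : Measurable (netHist P Z g (k + 1)) :=
    measurable_netHist h.measurable_traffic h.measurable_mac
      h.measurable_x0 (fun j (_ : j < k) => h.measurable_w j) h.measurable_v h.measurable_c le_rfl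
  -- The information at `k` includes the MAC output and transmission at `k` itself, hence the
  -- history at `k + 1`.
  have hle : infoSigma P Z g k
      ≤ MeasurableSpace.comap (netHist P Z g (k + 1)) inferInstance := by
    have hc : Measurable[MeasurableSpace.comap (netHist P Z g (k + 1)) inferInstance]
        (netHist P Z g (k + 1)) := comap_measurable _
    refine Measurable.comap_le (measurable_info_of_sentInnov P Z hg k (fun i hi => ?_)
      fun i hi => ?_)
    · exact ((measurable_pi_apply (⟨i, by omega⟩ : Fin (k + 1))).comp measurable_snd.fst).comp hc
    · exact ((measurable_pi_apply (⟨i, by omega⟩ : Fin (k + 1))).comp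
        measurable_snd.snd.fst).comp hc
  -- Doob–Dynkin factorization through the history; the standard Borel assumption serves here.
  obtain ⟨φ, hφ, rfl⟩ := (ha.mono hle le_rfl).exists_eq_measurable_comp
  have key : SignFree μ (netHist P Z g (k + 1)) (err P Z g k) :=
    h.signFree_err_of_innov (h.signFree_innov g k)
  exact key.comp hH (measurable_err hsig.1 hsig.2.2) hφ

end Network

end DualPredictor

namespace DualPredictor

/-! ### Algebra of quadratic forms. -/

section LinearQuadratic

variable {p q : ℕ}

theorem quad_eq_inner (Q : Matrix (Fin p) (Fin p) ℝ) (x : E p) : quad Q x = inner ℝ (act Q x) x := by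
  simp [quad, act, EuclideanSpace.inner_eq_star_dotProduct]

theorem quad_eq_sum (Q : Matrix (Fin p) (Fin p) ℝ) (x : E p) :
    quad Q x = ∑ i, ∑ j, Q i j * (x i * x j) := by
  simp only [quad, dotProduct, mulVec, Finset.mul_sum]
  exact Finset.sum_congr rfl fun i _ => Finset.sum_congr rfl fun j _ => by ring

theorem act_mul {r : ℕ} (M : Matrix (Fin p) (Fin q) ℝ) (M' : Matrix (Fin q) (Fin r) ℝ) (x : E r) :
    act (M * M') x = act M (act M' x) := by
  simp [act, mulVec_mulVec]

theorem add_act (M M' : Matrix (Fin p) (Fin q) ℝ) (x : E q) :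
    act (M + M') x = act M x + act M' x := by
  simp [act, add_mulVec]

theorem sub_act (M M' : Matrix (Fin p) (Fin q) ℝ) (x : E q) :
    act (M - M') x = act M x - act M' x := by
  simp [act, sub_mulVec]

theorem inner_act_left (M : Matrix (Fin p) (Fin q) ℝ) (x : E q) (y : E p) :
    inner ℝ (act M x) y = inner ℝ x (act Mᵀ y) := by
  simp only [act, EuclideanSpace.inner_eq_star_dotProduct, star_trivial]
  rw [dotProduct_mulVec, ← mulVec_transpose]

theorem quad_nonneg {Q : Matrix (Fin p) (Fin p) ℝ} (hQ : Q.PosSemidef) (x : E p) :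
    0 ≤ quad Q x := by
  simpa [quad] using hQ.dotProduct_mulVec_nonneg x.ofLp

theorem quad_pos {Q : Matrix (Fin p) (Fin p) ℝ} (hQ : Q.PosDef) {x : E p} (hx : x ≠ 0) :
    0 < quad Q x := by
  have : x.ofLp ≠ 0 := fun h => hx (by ext i; simp [h])
  simpa [quad] using hQ.dotProduct_mulVec_pos this

theorem quad_add {Q : Matrix (Fin p) (Fin p) ℝ} (hQ : Qᵀ = Q) (x y : E p) :
    quad Q (x + y) = quad Q x + quad Q y + 2 * inner ℝ (act Q x) y := by
  simp only [quad_eq_inner, act_add, inner_add_left, inner_add_right]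
  have : inner ℝ (act Q y) x = inner ℝ (act Q x) y := by
    rw [inner_act_left, hQ, real_inner_comm]
  rw [this]; ring

theorem quad_act (Q : Matrix (Fin p) (Fin p) ℝ) (M : Matrix (Fin p) (Fin q) ℝ) (x : E q) :
    quad Q (act M x) = quad (Mᵀ * Q * M) x := by
  rw [quad_eq_inner, quad_eq_inner, real_inner_comm, inner_act_left, real_inner_comm, act_mul,
    act_mul]

theorem add_quad (Q Q' : Matrix (Fin p) (Fin p) ℝ) (x : E p) :
    quad (Q + Q') x = quad Q x + quad Q' x := by
  simp only [quad_eq_inner, add_act, inner_add_left]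

theorem sub_quad (Q Q' : Matrix (Fin p) (Fin p) ℝ) (x : E p) :
    quad (Q - Q') x = quad Q x - quad Q' x := by
  simp only [quad_eq_inner, sub_act, inner_sub_left]

theorem quad_zero (Q : Matrix (Fin p) (Fin p) ℝ) : quad Q 0 = 0 := by
  rw [quad_eq_inner, inner_zero_right]

/-- Compactness of the unit sphere and homogeneity. With `Q2` this bounds the second moments of the
controls by the cost. -/
theorem exists_mul_norm_sq_le_quad {Q : Matrix (Fin p) (Fin p) ℝ} (hQ : Q.PosDef) :
    ∃ c > 0, ∀ x : E p, c * ‖x‖ ^ 2 ≤ quad Q x := by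
  have hhom : ∀ (a : ℝ) (x : E p), quad Q (a • x) = a ^ 2 * quad Q x := by
    intro a x
    simp only [quad_eq_inner, act_eq_actCLM, map_smul, real_inner_smul_left,
      real_inner_smul_right]
    ring
  rcases (Metric.sphere (0 : E p) 1).eq_empty_or_nonempty with he | hne
  -- The sphere is empty only when the space is trivial, and then any constant works.
  · refine ⟨1, one_pos, fun x => ?_⟩
    have hx : x = 0 := by
      by_contra hx
      have : (‖x‖⁻¹ • x) ∈ Metric.sphere (0 : E p) 1 := by
        simp [norm_smul, inv_mul_cancel₀ (norm_ne_zero_iff.2 hx)]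
      rw [he] at this
      exact this
    rw [hx, quad_zero]; simp
  · obtain ⟨z, hz, hmin⟩ := (isCompact_sphere (0 : E p) 1).exists_isMinOn hne
      (continuous_quad Q).continuousOn
    have hz0 : z ≠ 0 := by
      rintro rfl
      simp at hz
    refine ⟨quad Q z, quad_pos hQ hz0, fun x => ?_⟩
    rcases eq_or_ne x 0 with rfl | hx
    · simp [quad_zero]
    have hx' : ‖x‖ ≠ 0 := norm_ne_zero_iff.2 hx
    have hmem : (‖x‖⁻¹ • x) ∈ Metric.sphere (0 : E p) 1 := by
      simp [norm_smul, inv_mul_cancel₀ hx']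
    have h1 : quad Q z ≤ quad Q (‖x‖⁻¹ • x) := hmin hmem
    calc quad Q z * ‖x‖ ^ 2 ≤ quad Q (‖x‖⁻¹ • x) * ‖x‖ ^ 2 := by gcongr
      _ = quad Q x := by rw [hhom]; field_simp

end LinearQuadratic

/-! ### Riccati recursion and the noise-free problem. -/

namespace Loop

variable {n m : ℕ} {V C : Type*} (P : Loop n m V C)

/-- The weights of the plant are positive (semi)definite. -/
structure PosWeights : Prop where
  Q0 : P.Q0.PosSemidef
  Q1 : P.Q1.PosSemidef
  Q2 : P.Q2.PosDef

/-- The weight of the control deviation in the Riccati step from `S`. -/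
noncomputable def ctrlWeight (S : Matrix (Fin n) (Fin n) ℝ) : Matrix (Fin m) (Fin m) ℝ :=
  P.Q2 + P.Bᵀ * S * P.B

/-- The gain in the Riccati step from `S`. -/
noncomputable def gain (S : Matrix (Fin n) (Fin n) ℝ) : Matrix (Fin m) (Fin n) ℝ :=
  (P.ctrlWeight S)⁻¹ * (P.Bᵀ * S * P.A)

variable {P} {S : Matrix (Fin n) (Fin n) ℝ}

theorem ctrlWeight_posDef (hP : P.PosWeights) (hS : S.PosSemidef) : (P.ctrlWeight S).PosDef := by
  have := hS.conjTranspose_mul_mul_same P.B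
  rw [conjTranspose_eq_transpose_of_trivial] at this
  exact hP.Q2.add_posSemidef this

theorem ctrlWeight_mul_gain (hP : P.PosWeights) (hS : S.PosSemidef) :
    P.ctrlWeight S * P.gain S = P.Bᵀ * S * P.A := by
  have hu := (isUnit_iff_isUnit_det _).1 (ctrlWeight_posDef hP hS).isUnit
  rw [gain, ← Matrix.mul_assoc, mul_nonsing_inv _ hu, Matrix.one_mul]

theorem _root_.Matrix.PosSemidef.transpose_eq {d : ℕ} {M : Matrix (Fin d) (Fin d) ℝ}
    (h : M.PosSemidef) : Mᵀ = M := by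
  have := h.isHermitian.eq
  rwa [conjTranspose_eq_transpose_of_trivial] at this

/-- The subtracted term becomes a quadratic form in the gain, by substituting the normal equation
`ctrlWeight_mul_gain` and its transpose. This is the shape that completing the square produces. -/
theorem riccatiStep_eq (hP : P.PosWeights) (hS : S.PosSemidef) :
    P.riccatiStep S = P.Q1 + P.Aᵀ * S * P.A - (P.gain S)ᵀ * P.ctrlWeight S * P.gain S := by
  have h1 : (P.gain S)ᵀ * P.ctrlWeight S = P.Aᵀ * S * P.B := by
    have := congrArg transpose (ctrlWeight_mul_gain hP hS)
    simpa only [transpose_mul, transpose_transpose, hS.transpose_eq,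
      (ctrlWeight_posDef hP hS).posSemidef.transpose_eq, Matrix.mul_assoc] using this
  rw [h1]
  simp only [riccatiStep, gain, ctrlWeight, Matrix.mul_assoc]

/-- Completion of the square. -/
theorem quad_step (hP : P.PosWeights) (hS : S.PosSemidef) (x : E n) (u : E m) :
    quad P.Q1 x + quad P.Q2 u + quad S (act P.A x + act P.B u)
      = quad (P.riccatiStep S) x + quad (P.ctrlWeight S) (u + act (P.gain S) x) := by
  have hW := (ctrlWeight_posDef hP hS).posSemidef.transpose_eq
  have h1 : inner ℝ (act S (act P.A x)) (act P.B u)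
      = inner ℝ (act (P.ctrlWeight S) u) (act (P.gain S) x) := by
    rw [inner_act_left (P.ctrlWeight S), hW, ← act_mul (P.ctrlWeight S),
      ctrlWeight_mul_gain hP hS, real_inner_comm, inner_act_left P.B, act_mul, act_mul]
  rw [riccatiStep_eq hP hS, quad_add hS.transpose_eq, quad_add hW, h1, sub_quad, add_quad,
    quad_act, quad_act, quad_act]
  have h2 : quad (P.ctrlWeight S) u = quad P.Q2 u + quad (P.Bᵀ * S * P.B) u := by
    rw [ctrlWeight, add_quad]
  rw [h2]
  ring

theorem riccatiStep_posSemidef (hP : P.PosWeights) (hS : S.PosSemidef) :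
    (P.riccatiStep S).PosSemidef := by
  refine PosSemidef.of_dotProduct_mulVec_nonneg ?_ fun x => ?_
  · rw [IsHermitian, conjTranspose_eq_transpose_of_trivial, riccatiStep_eq hP hS]
    simp only [transpose_sub, transpose_add, transpose_mul, transpose_transpose,
      hS.transpose_eq, hP.Q1.transpose_eq,
      (ctrlWeight_posDef hP hS).posSemidef.transpose_eq, Matrix.mul_assoc]
  -- At the minimizing control the square vanishes, so the new form equals a sum of nonnegative
  -- one-step costs.
  · have h := quad_step hP hS (WithLp.toLp 2 x) (-act (P.gain S) (WithLp.toLp 2 x))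
    rw [neg_add_cancel, quad_zero, add_zero] at h
    have h' : 0 ≤ quad (P.riccatiStep S) (WithLp.toLp 2 x) := by
      rw [← h]
      exact add_nonneg (add_nonneg (quad_nonneg hP.Q1 _) (quad_nonneg hP.Q2.posSemidef _))
        (quad_nonneg hS _)
    simpa [quad] using h'

/-- No bound on `k` is needed: truncated subtraction gives `S k = Q0` beyond the horizon. -/
theorem S_posSemidef (hP : P.PosWeights) (k : ℕ) : (P.S k).PosSemidef := by
  unfold Loop.S
  induction P.N - k with
  | zero => exact hP.Q0
  | succ j ih =>
    rw [Function.iterate_succ_apply']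
    exact riccatiStep_posSemidef hP ih

theorem S_horizon : P.S P.N = P.Q0 := by simp [Loop.S]

theorem S_eq_riccatiStep {k : ℕ} (hk : k < P.N) : P.S k = P.riccatiStep (P.S (k + 1)) := by
  unfold Loop.S
  rw [← Function.iterate_succ_apply' (f := P.riccatiStep)]
  congr 1
  omega

theorem L_eq_gain (k : ℕ) : P.L k = P.gain (P.S (k + 1)) := rfl

/-- Verification by backward induction: each step discards the nonnegative completed square, which
is zero for the gain feedback (`detCost_gain`). -/
theorem quad_S_le_detCost (hP : P.PosWeights) (ψ : ℕ → E n → E m) (j k : ℕ) (hk : k + j = P.N)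
    (x : E n) : quad (P.S k) x ≤ P.detCost ψ j k x := by
  induction j generalizing k x with
  | zero =>
    obtain rfl : k = P.N := by omega
    rw [S_horizon, detCost]
  | succ j ih =>
    have h1 := quad_step hP (S_posSemidef hP (k + 1)) x (ψ k x)
    have h2 := ih (k + 1) (by omega) (act P.A x + act P.B (ψ k x))
    have h3 := quad_nonneg (ctrlWeight_posDef hP (S_posSemidef hP (k + 1))).posSemidef
      (ψ k x + act (P.gain (P.S (k + 1))) x)
    rw [detCost, S_eq_riccatiStep (by omega)]
    linarith

theorem detCost_gain (hP : P.PosWeights) (j k : ℕ) (hk : k + j = P.N) (x : E n) :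
    P.detCost (fun k x => -act (P.L k) x) j k x = quad (P.S k) x := by
  induction j generalizing k x with
  | zero =>
    obtain rfl : k = P.N := by omega
    rw [S_horizon, detCost]
  | succ j ih =>
    have h1 := quad_step hP (S_posSemidef hP (k + 1)) x (-act (P.L k) x)
    rw [L_eq_gain, neg_add_cancel, quad_zero, add_zero, ← L_eq_gain] at h1
    rw [detCost, ih (k + 1) (by omega), S_eq_riccatiStep (k := k) (by omega), h1]

theorem isDetOptimal_gain (hP : P.PosWeights) : P.IsDetOptimal fun k x => -act (P.L k) x := by
  intro k hk x ψ
  rw [detCost_gain hP _ _ (by omega)]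
  exact quad_S_le_detCost hP ψ _ _ (by omega) x

end Loop

/-! ### Moments of quadratic forms and Gaussian vectors. -/

section Moments

variable {Ω : Type*} [MeasurableSpace Ω] {μ : Measure Ω} {d : ℕ}

theorem memLp_coord {r : ℝ≥0∞} {f : Ω → E d} (hf : MemLp f r μ) (i : Fin d) :
    MemLp (fun ω => f ω i) r μ :=
  (EuclideanSpace.proj (𝕜 := ℝ) i : E d →L[ℝ] ℝ).comp_memLp' hf

theorem integrable_inner_of_memLp {f f' : Ω → E d} (hf : MemLp f 2 μ) (hf' : MemLp f' 2 μ) :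
    Integrable (fun ω => inner ℝ (f ω) (f' ω)) μ := by
  simp only [PiLp.inner_apply]
  refine integrable_finsetSum _ fun i _ => ?_
  exact (memLp_coord hf' i).integrable_mul (memLp_coord hf i)

theorem integrable_quad (Q : Matrix (Fin d) (Fin d) ℝ) {f : Ω → E d} (hf : MemLp f 2 μ) :
    Integrable (fun ω => quad Q (f ω)) μ := by
  simp only [quad_eq_inner]
  exact integrable_inner_of_memLp (memLp_act Q hf) hf

theorem integral_quad (Q : Matrix (Fin d) (Fin d) ℝ) {f : Ω → E d} (hf : MemLp f 2 μ) :
    ∫ ω, quad Q (f ω) ∂μ = ∑ i, ∑ j, Q i j * ∫ ω, f ω i * f ω j ∂μ := by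
  have hi : ∀ i j, Integrable (fun ω => Q i j * (f ω i * f ω j)) μ := fun i j =>
    ((memLp_coord hf i).integrable_mul (memLp_coord hf j)).const_mul _
  simp only [quad_eq_sum]
  rw [integral_finsetSum _ fun i _ => integrable_finsetSum _ fun j _ => hi i j]
  refine Finset.sum_congr rfl fun i _ => ?_
  rw [integral_finsetSum _ fun j _ => hi i j]
  exact Finset.sum_congr rfl fun j _ => integral_const_mul _ _

variable {R : Matrix (Fin d) (Fin d) ℝ} {f : Ω → E d}

theorem memLp_of_map_eq_gaussian (hf : Measurable f) (h : μ.map f = multivariateGaussian 0 R)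
    {r : ℝ≥0∞} (hr : r ≠ ∞) : MemLp f r μ := by
  have := IsGaussian.memLp_id (multivariateGaussian (0 : E d) R) r hr
  rw [← h] at this
  exact (memLp_map_measure_iff (by fun_prop) hf.aemeasurable).1 this

theorem integral_of_map_eq_gaussian (hf : Measurable f)
    (h : μ.map f = multivariateGaussian 0 R) : ∫ ω, f ω ∂μ = 0 := by
  have := integral_map (μ := μ) (f := fun x : E d => x) hf.aemeasurable (by fun_prop)
  rw [← this, h, integral_id_multivariateGaussian]

theorem integral_quad_of_map_eq_gaussian (hR : R.PosSemidef) (Q : Matrix (Fin d) (Fin d) ℝ)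
    (hf : Measurable f) (h : μ.map f = multivariateGaussian 0 R) :
    ∫ ω, quad Q (f ω) ∂μ = (Q * R).trace := by
  have hL := memLp_of_map_eq_gaussian hf h (r := 2) (by simp)
  rw [integral_quad Q hL]
  have hG : MemLp (fun x : E d => x) 2 (multivariateGaussian (0 : E d) R) :=
    IsGaussian.memLp_id _ 2 (by simp)
  have hz : ∀ i, ∫ x : E d, x i ∂(multivariateGaussian (0 : E d) R) = 0 := by
    intro i
    have := (EuclideanSpace.proj (𝕜 := ℝ) i : E d →L[ℝ] ℝ).integral_comp_comm
      (hG.integrable (by simp))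
    rw [integral_id_multivariateGaussian] at this
    simpa using this
  have hc : ∀ i j, ∫ ω, f ω i * f ω j ∂μ = R i j := by
    intro i j
    have h1 := covariance_eval_multivariateGaussian (μ := (0 : E d)) hR i j
    rw [covariance_eq_sub (memLp_coord hG i) (memLp_coord hG j), hz, hz, mul_zero, sub_zero,
      ← h] at h1
    rw [← h1]
    exact (integral_map (f := fun x : E d => x i * x j) hf.aemeasurable (by fun_prop)).symm
  simp only [hc, trace, diag, Matrix.mul_apply]
  refine Finset.sum_congr rfl fun i _ => Finset.sum_congr rfl fun j _ => ?_
  -- The trace produces the transposed entry of `R`, so symmetry is used.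
  rw [← congrFun (congrFun hR.transpose_eq i) j]
  rfl

end Moments

end DualPredictor

namespace DualPredictor

variable {Ω V C : Type*} [MeasurableSpace V] [MeasurableSpace C] {n m : ℕ} {P : Loop n m V C}
  {Z : Primitives Ω n V C} {g : Law n m} [MeasurableSpace Ω] {μ : Measure Ω}

theorem integral_add_six {f₁ f₂ f₃ f₄ f₅ f₆ : Ω → ℝ} (h₁ : Integrable f₁ μ)
    (h₂ : Integrable f₂ μ) (h₃ : Integrable f₃ μ) (h₄ : Integrable f₄ μ) (h₅ : Integrable f₅ μ)
    (h₆ : Integrable f₆ μ) :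
    ∫ ω, (f₁ ω + f₂ ω + f₃ ω + f₄ ω + f₅ ω + f₆ ω) ∂μ
      = ∫ ω, f₁ ω ∂μ + ∫ ω, f₂ ω ∂μ + ∫ ω, f₃ ω ∂μ + ∫ ω, f₄ ω ∂μ + ∫ ω, f₅ ω ∂μ
        + ∫ ω, f₆ ω ∂μ := by
  have k₂ := h₁.add h₂
  have k₃ := k₂.add h₃
  have k₄ := k₃.add h₄
  have k₅ := k₄.add h₅
  rw [← integral_add' h₁ h₂, ← integral_add' k₂ h₃, ← integral_add' k₃ h₄, ← integral_add' k₄ h₅,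
    ← integral_add' k₅ h₆]
  rfl

/-! ### Estimation, dual effect and cost under the standing assumptions. -/

namespace Standing

theorem posWeights (h : Standing P Z μ) : P.PosWeights :=
  ⟨h.Q0_posSemidef, h.Q1_posSemidef, h.Q2_posDef⟩

theorem measurable_network_signals (h : Standing P Z μ) (g : Law n m) (k : ℕ) :
    Measurable (innov P Z g k) ∧ Measurable (gam P Z g k) ∧ Measurable (del P Z g k) :=
  DualPredictor.measurable_network_signals h.measurable_traffic h.measurable_mac
    h.measurable_x0 (fun j (_ : j < k) => h.measurable_w j) h.measurable_v h.measurable_c g k le_rfl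

theorem measurable_err (h : Standing P Z μ) (g : Law n m) (k : ℕ) : Measurable (err P Z g k) :=
  DualPredictor.measurable_err (h.measurable_network_signals g k).1
    (h.measurable_network_signals g k).2.2

theorem measurable_info (h : Standing P Z μ) (hg : g.Admissible) (k : ℕ) :
    Measurable (info P Z g k) :=
  DualPredictor.measurable_info h.measurable_traffic h.measurable_mac
    h.measurable_x0 (fun j (_ : j < k) => h.measurable_w j) h.measurable_v h.measurable_c hg

theorem infoSigma_le (h : Standing P Z μ) (hg : g.Admissible) (k : ℕ) :
    infoSigma P Z g k ≤ ‹MeasurableSpace Ω› :=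
  (h.measurable_info hg k).comap_le

theorem measurable_ctrl (h : Standing P Z μ) (hg : g.Admissible) (k : ℕ) :
    Measurable (ctrl P Z g k) :=
  (measurable_ctrl_infoSigma P Z hg k).mono (h.infoSigma_le hg k) le_rfl

theorem memLp_x0 (h : Standing P Z μ) {r : ℝ≥0∞} (hr : r ≠ ∞) : MemLp Z.x0 r μ :=
  memLp_of_map_eq_gaussian h.measurable_x0 h.law_x0 hr

theorem memLp_w (h : Standing P Z μ) (k : ℕ) {r : ℝ≥0∞} (hr : r ≠ ∞) : MemLp (Z.w k) r μ :=
  memLp_of_map_eq_gaussian (h.measurable_w k) (h.law_w k) hr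

/-- Censoring only shrinks the norm, and Gaussian noise has all finite moments. Nothing is asked of
the law, because the control has cancelled. -/
theorem memLp_innov (h : Standing P Z μ) (g : Law n m) (k : ℕ) {r : ℝ≥0∞} (hr : r ≠ ∞) :
    MemLp (innov P Z g k) r μ := by
  induction k with
  | zero =>
    rw [show innov P Z g 0 = Z.x0 from funext (innov_zero P Z g)]
    exact h.memLp_x0 hr
  | succ k ih =>
    have he : MemLp (err P Z g k) r μ :=
      ih.of_le (h.measurable_err g k).aestronglyMeasurable
        (Filter.Eventually.of_forall (norm_err_le P Z g k))
    rw [show innov P Z g (k + 1) = _ from funext (innov_succ P Z g k)]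
    exact (memLp_act _ he).add (h.memLp_w k hr)

/-- The estimation error has moments of every order. -/
theorem memLp_err (h : Standing P Z μ) (g : Law n m) (k : ℕ) {r : ℝ≥0∞} (hr : r ≠ ∞) :
    MemLp (err P Z g k) r μ :=
  (h.memLp_innov g k hr).of_le (h.measurable_err g k).aestronglyMeasurable
    (Filter.Eventually.of_forall (norm_err_le P Z g k))

/-- The state inherits the integrability of the controls. -/
theorem memLp_state (h : Standing P Z μ) {r : ℝ≥0∞} (hr : r ≠ ∞)
    (hu : ∀ k < P.N, MemLp (ctrl P Z g k) r μ) (k : ℕ) (hk : k ≤ P.N) :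
    MemLp (state P Z g k) r μ := by
  induction k with
  | zero =>
    rw [show state P Z g 0 = Z.x0 from funext (state_zero P Z g)]
    exact h.memLp_x0 hr
  | succ k ih =>
    rw [show state P Z g (k + 1) = _ from funext (state_succ P Z g k)]
    exact ((memLp_act _ (ih (by omega))).add (memLp_act _ (hu k (by omega)))).add (h.memLp_w k hr)

theorem estimate_eq_state_sub_err :
    ∀ k, estimate P Z g k = fun ω => state P Z g k ω - err P Z g k ω := by
  intro k; funext ω; simp [err]

theorem memLp_estimate (h : Standing P Z μ) {r : ℝ≥0∞} (hr : r ≠ ∞)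
    (hu : ∀ k < P.N, MemLp (ctrl P Z g k) r μ) (k : ℕ) (hk : k ≤ P.N) :
    MemLp (estimate P Z g k) r μ := by
  rw [estimate_eq_state_sub_err]
  exact (h.memLp_state hr hu k hk).sub (h.memLp_err g k hr)

theorem ctrl_controller (k : ℕ) (ω : Ω) :
    ctrl P Z P.controller k ω = -act (P.L k) (estimate P Z P.controller k ω) :=
  ctrl_eq P Z P.controller k ω

/-- The estimate is the state minus an error with all moments, so linear feedback passes moments
from state to control and on to the next state. -/
theorem memLp_ctrl_controller (h : Standing P Z μ) {r : ℝ≥0∞} (hr : r ≠ ∞) (k : ℕ) :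
    MemLp (ctrl P Z P.controller k) r μ := by
  have key : ∀ k, MemLp (state P Z P.controller k) r μ → MemLp (ctrl P Z P.controller k) r μ := by
    intro k hk
    rw [show ctrl P Z P.controller k = _ from funext (ctrl_controller k)]
    have he : MemLp (estimate P Z P.controller k) r μ := by
      rw [estimate_eq_state_sub_err]
      exact hk.sub (h.memLp_err _ k hr)
    exact (memLp_act _ he).neg
  refine key k ?_
  induction k with
  | zero =>
    rw [show state P Z P.controller 0 = Z.x0 from funext (state_zero P Z P.controller)]
    exact h.memLp_x0 hr
  | succ k ih =>
    rw [show state P Z P.controller (k + 1) = _ from funext (state_succ P Z P.controller k)]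
    exact ((memLp_act _ ih).add (memLp_act _ (key k ih))).add (h.memLp_w k hr)

variable [IsProbabilityMeasure μ]

theorem integrableControls_controller (h : Standing P Z μ) :
    IntegrableControls P Z P.controller μ := fun k _ =>
  memLp_one_iff_integrable.1 (h.memLp_ctrl_controller (by simp) k)

/-- The estimate of the observer minimizes the mean square error. -/
theorem lintegral_norm_sub_estimate_le (h : Standing P Z μ) (hg : g.Admissible) (k : ℕ)
    {z : Ω → E n} (hz : Measurable[infoSigma P Z g k] z) :
    ∫⁻ ω, ENNReal.ofReal (‖state P Z g k ω - estimate P Z g k ω‖ ^ 2) ∂μ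
      ≤ ∫⁻ ω, ENNReal.ofReal (‖state P Z g k ω - z ω‖ ^ 2) ∂μ := by
  -- The competing error is the observer's error plus this information-measurable shift.
  have ha : Measurable[infoSigma P Z g k] fun ω => estimate P Z g k ω - z ω :=
    (measurable_estimate_infoSigma P Z g k).sub hz
  have := (h.signFree_err hg k ha).lintegral_norm_sq_le (ha.mono (h.infoSigma_le hg k) le_rfl)
    (h.measurable_err g k)
  simpa only [err, sub_add_sub_cancel] using this

theorem condExp_err (h : Standing P Z μ) (hg : g.Admissible) (k : ℕ) :
    μ[err P Z g k | infoSigma P Z g k] =ᵐ[μ] 0 := by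
  have hle := h.infoSigma_le hg k
  refine (ae_eq_condExp_of_forall_setIntegral_eq hle
    ((h.memLp_err g k (r := 1) (by simp)).integrable le_rfl)
    (fun s _ _ => (integrable_zero _ _ _).integrableOn) (fun s hs _ => ?_)
    stronglyMeasurable_zero.aestronglyMeasurable).symm
  have ha : Measurable[infoSigma P Z g k] (s.indicator (fun _ => (1 : ℝ))) :=
    Measurable.indicator measurable_const hs
  have h0 := (h.signFree_err hg k ha).integral_smul_eq_zero (ha.mono hle le_rfl)
    (h.measurable_err g k)
  rw [← integral_indicator (hle s hs), ← integral_indicator (hle s hs)]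
  have hz : ∫ ω, s.indicator (0 : Ω → E n) ω ∂μ = 0 := by simp
  refine (hz.trans h0.symm).trans (integral_congr_ae (Filter.Eventually.of_forall fun ω => ?_))
  by_cases hω : ω ∈ s <;> simp [hω]

theorem integrable_state (h : Standing P Z μ) (hu : IntegrableControls P Z g μ) (k : ℕ)
    (hk : k ≤ P.N) : Integrable (state P Z g k) μ :=
  memLp_one_iff_integrable.1
    (h.memLp_state (by simp) (fun k hk => memLp_one_iff_integrable.2 (hu k hk)) k hk)

theorem condMean_ae_eq (h : Standing P Z μ) (hg : g.Admissible)
    (hu : IntegrableControls P Z g μ) (k : ℕ) (hk : k ≤ P.N) :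
    condMean P Z g μ k =ᵐ[μ] estimate P Z g k := by
  have hle := h.infoSigma_le hg k
  have hei : Integrable (err P Z g k) μ := (h.memLp_err g k (r := 1) (by simp)).integrable le_rfl
  have hest : Integrable (estimate P Z g k) μ := by
    rw [estimate_eq_state_sub_err]
    exact (h.integrable_state hu k hk).sub hei
  have hs : state P Z g k = estimate P Z g k + err P Z g k := by
    funext ω; simp [err]
  rw [condMean, hs]
  refine (condExp_add hest hei _).trans ?_
  rw [condExp_of_stronglyMeasurable hle
    (measurable_estimate_infoSigma P Z g k).stronglyMeasurable hest]
  filter_upwards [h.condExp_err hg k] with ω hω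
  simp [hω]

/-- Replaces the conditional mean by the estimate, exposing a quantity that does not depend on the
law. -/
theorem centralPower_ae_eq (h : Standing P Z μ) (hg : g.Admissible)
    (hu : IntegrableControls P Z g μ) (r k : ℕ) (hk : k ≤ P.N) (i : Fin n) :
    centralPower P Z g μ r k i =ᵐ[μ] fun ω => err P Z g k ω i ^ r := by
  have h1 := (EuclideanSpace.proj (𝕜 := ℝ) i : E n →L[ℝ] ℝ).comp_condExp_comm
    (m := infoSigma P Z g k) (h.integrable_state hu k hk)
  filter_upwards [h1, h.condMean_ae_eq hg hu k hk] with ω h1 h2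
  rw [centralPower, err, PiLp.sub_apply, ← h2]
  congr 2
  exact h1.symm

theorem noDualEffect (h : Standing P Z μ) (r : ℕ) : NoDualEffect P Z μ r := by
  intro g hg hu k hk i
  have hu0 : IntegrableControls P Z (zeroLaw n m) μ := by
    intro j _
    rw [show ctrl P Z (zeroLaw n m) j = fun _ => 0 from funext fun ω => ctrl_eq P Z _ j ω]
    exact integrable_zero _ _ _
  have h1 := h.centralPower_ae_eq hg hu r k hk i
  have h2 := h.centralPower_ae_eq (zeroLaw_admissible n m) hu0 r k hk i
  have h3 : (fun ω => err P Z g k ω i ^ r) = fun ω => err P Z (zeroLaw n m) k ω i ^ r :=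
    funext fun ω => by rw [err_congr P Z g (zeroLaw n m)]
  have hσ := infoSigma_congr P Z hg (zeroLaw_admissible n m) k
  refine ⟨?_, ?_, ?_⟩
  · refine Integrable.congr ?_ h1.symm
    have hm : MemLp (fun ω => err P Z g k ω i) r μ := memLp_coord (h.memLp_err g k (by simp)) i
    refine hm.integrable_norm_pow'.mono' (hm.aestronglyMeasurable.pow r) ?_
    exact Filter.Eventually.of_forall fun ω => by simp
  · rw [hσ]
  · rw [hσ]
    exact condExp_congr_ae (h1.trans (h3 ▸ h2.symm))

/-- The expected cost of one step, by completion of the square. -/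
theorem integral_step (h : Standing P Z μ) (hg : g.Admissible)
    (hu : ∀ k < P.N, MemLp (ctrl P Z g k) 2 μ) (k : ℕ) (hk : k < P.N) :
    ∫ ω, (quad P.Q1 (state P Z g k ω) + quad P.Q2 (ctrl P Z g k ω)) ∂μ
        + ∫ ω, quad (P.S (k + 1)) (state P Z g (k + 1) ω) ∂μ
      = ∫ ω, quad (P.S k) (state P Z g k ω) ∂μ
        + ((P.S (k + 1) * P.Rw).trace
          + ∫ ω, quad ((P.L k)ᵀ * P.ctrlWeight (P.S (k + 1)) * P.L k) (err P Z g k ω) ∂μ)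
        + ∫ ω, quad (P.ctrlWeight (P.S (k + 1)))
            (ctrl P Z g k ω + act (P.L k) (estimate P Z g k ω)) ∂μ := by
  set S' := P.S (k + 1) with hS'
  set W := P.ctrlWeight S' with hW
  have hSp : S'.PosSemidef := Loop.S_posSemidef h.posWeights (k + 1)
  have hWt : Wᵀ = W := (Loop.ctrlWeight_posDef h.posWeights hSp).posSemidef.transpose_eq
  have hx := h.memLp_state (by simp) hu k hk.le
  have huk := hu k hk
  have hw := h.memLp_w k (r := 2) (by simp)
  have he := h.memLp_err g k (r := 2) (by simp)
  have hest := h.memLp_estimate (by simp) hu k hk.le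
  have hdrift : MemLp (fun ω => act P.A (state P Z g k ω) + act P.B (ctrl P Z g k ω)) 2 μ :=
    (memLp_act _ hx).add (memLp_act _ huk)
  have hdev : MemLp (fun ω => ctrl P Z g k ω + act (P.L k) (estimate P Z g k ω)) 2 μ :=
    huk.add (memLp_act _ hest)
  -- State and control at `k` are functions of `past Z k`, hence independent of the symmetric `w k`.
  have hc1 : ∫ ω, inner ℝ (act S' (act P.A (state P Z g k ω) + act P.B (ctrl P Z g k ω)))
      (Z.w k ω) ∂μ = 0 := by
    have hxp : Measurable[MeasurableSpace.comap (past Z k) inferInstance] (state P Z g k) :=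
      DualPredictor.measurable_state h.measurable_traffic h.measurable_mac (measurable_x0_past Z k)
        (measurable_w_past Z k) (measurable_v_past Z k) (measurable_c_past Z k) hg
    have hup : Measurable[MeasurableSpace.comap (past Z k) inferInstance] (ctrl P Z g k) :=
      DualPredictor.measurable_ctrl h.measurable_traffic h.measurable_mac (measurable_x0_past Z k)
        (measurable_w_past Z k) (measurable_v_past Z k) (measurable_c_past Z k) hg
    have hap : Measurable[MeasurableSpace.comap (past Z k) inferInstance] fun ω =>
        act S' (act P.A (state P Z g k ω) + act P.B (ctrl P Z g k ω)) :=
      (measurable_act _).comp (((measurable_act _).comp hxp).add ((measurable_act _).comp hup))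
    have ha := hap.mono (h.measurable_past k).comap_le le_rfl
    exact SignFree.integral_inner_eq_zero (map_prodMk_neg_of_indepFun ha (h.measurable_w k)
      (h.indepFun_of_measurable_past hap) (h.map_neg_w k)) ha (h.measurable_w k)
  -- Moving `L k` to the other side by transposition leaves an information-measurable vector paired
  -- with the error, so sign symmetry applies.
  have hc2 : ∫ ω, inner ℝ (act W (ctrl P Z g k ω + act (P.L k) (estimate P Z g k ω)))
      (act (P.L k) (err P Z g k ω)) ∂μ = 0 := by
    have hai : Measurable[infoSigma P Z g k] fun ω =>
        act (P.L k)ᵀ (act W (ctrl P Z g k ω + act (P.L k) (estimate P Z g k ω))) :=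
      (measurable_act _).comp ((measurable_act _).comp ((measurable_ctrl_infoSigma P Z hg k).add
        ((measurable_act _).comp (measurable_estimate_infoSigma P Z g k))))
    have := (h.signFree_err hg k hai).integral_inner_eq_zero
      (hai.mono (h.infoSigma_le hg k) le_rfl) (h.measurable_err g k)
    simpa only [inner_act_left, transpose_transpose] using this
  -- The completed square is expanded after splitting the state into estimate and error, and the
  -- next state into drift and noise.
  have hpt : ∀ ω, quad P.Q1 (state P Z g k ω) + quad P.Q2 (ctrl P Z g k ω)
      + quad S' (state P Z g (k + 1) ω)
      = quad (P.S k) (state P Z g k ω) + quad S' (Z.w k ω)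
        + quad ((P.L k)ᵀ * W * P.L k) (err P Z g k ω)
        + quad W (ctrl P Z g k ω + act (P.L k) (estimate P Z g k ω))
        + 2 * inner ℝ (act S' (act P.A (state P Z g k ω) + act P.B (ctrl P Z g k ω))) (Z.w k ω)
        + 2 * inner ℝ (act W (ctrl P Z g k ω + act (P.L k) (estimate P Z g k ω)))
          (act (P.L k) (err P Z g k ω)) := by
    intro ω
    have h1 := Loop.quad_step h.posWeights hSp (state P Z g k ω) (ctrl P Z g k ω)
    have h2 : ctrl P Z g k ω + act (P.gain S') (state P Z g k ω)
        = (ctrl P Z g k ω + act (P.L k) (estimate P Z g k ω)) + act (P.L k) (err P Z g k ω) := by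
      rw [err, act_sub, Loop.L_eq_gain]
      abel
    rw [h2, ← Loop.S_eq_riccatiStep hk, quad_add hWt, quad_act W] at h1
    rw [state_succ, quad_add hSp.transpose_eq]
    linarith
  have i1 : Integrable (fun ω => quad P.Q1 (state P Z g k ω) + quad P.Q2 (ctrl P Z g k ω)) μ :=
    (integrable_quad _ hx).add (integrable_quad _ huk)
  have i2 := integrable_quad S' (h.memLp_state (by simp) hu (k + 1) hk)
  have j1 := integrable_quad (P.S k) hx
  have j2 := integrable_quad S' hw
  have j3 := integrable_quad ((P.L k)ᵀ * W * P.L k) he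
  have j4 := integrable_quad W hdev
  have j5 := (integrable_inner_of_memLp (memLp_act S' hdrift) hw).const_mul 2
  have j6 := (integrable_inner_of_memLp (memLp_act W hdev) (memLp_act (P.L k) he)).const_mul 2
  rw [← integral_add i1 i2, integral_congr_ae (Filter.Eventually.of_forall hpt),
    integral_add_six j1 j2 j3 j4 j5 j6, integral_const_mul, integral_const_mul, hc1,
    hc2, integral_quad_of_map_eq_gaussian h.Rw_posSemidef S' (h.measurable_w k) (h.law_w k)]
  ring

theorem integrable_realizedCost (h : Standing P Z μ)
    (hu : ∀ k < P.N, MemLp (ctrl P Z g k) 2 μ) : Integrable (realizedCost P Z g) μ := by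
  refine (integrable_quad _ (h.memLp_state (by simp) hu P.N le_rfl)).add
    (integrable_finsetSum _ fun s hs => ?_)
  have hs' := Finset.mem_range.1 hs
  exact (integrable_quad _ (h.memLp_state (by simp) hu s hs'.le)).add
    (integrable_quad _ (hu s hs'))

/-- The expected cost is the sum of a part that no control law influences, and of the weighted mean
square deviation of the controls from those of the architecture. -/
theorem integral_realizedCost (h : Standing P Z μ) (hg : g.Admissible)
    (hu : ∀ k < P.N, MemLp (ctrl P Z g k) 2 μ) :
    ∫ ω, realizedCost P Z g ω ∂μ
      = (P.S 0 * P.R0).trace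
        + ∑ k ∈ Finset.range P.N, ((P.S (k + 1) * P.Rw).trace
          + ∫ ω, quad ((P.L k)ᵀ * P.ctrlWeight (P.S (k + 1)) * P.L k) (err P Z g k ω) ∂μ)
        + ∑ k ∈ Finset.range P.N, ∫ ω, quad (P.ctrlWeight (P.S (k + 1)))
            (ctrl P Z g k ω + act (P.L k) (estimate P Z g k ω)) ∂μ := by
  have hstage : ∀ s ∈ Finset.range P.N, Integrable (fun ω =>
      quad P.Q1 (state P Z g s ω) + quad P.Q2 (ctrl P Z g s ω)) μ := fun s hs =>
    (integrable_quad _ (h.memLp_state (by simp) hu s (Finset.mem_range.1 hs).le)).add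
      (integrable_quad _ (hu s (Finset.mem_range.1 hs)))
  have hterm := integrable_quad P.Q0 (h.memLp_state (by simp) hu P.N le_rfl)
  unfold realizedCost
  rw [integral_add hterm (integrable_finsetSum _ hstage), integral_finsetSum _ hstage]
  have h0 : ∫ ω, quad (P.S 0) (state P Z g 0 ω) ∂μ = (P.S 0 * P.R0).trace := by
    simp only [state_zero]
    exact integral_quad_of_map_eq_gaussian h.R0_posSemidef _ h.measurable_x0 h.law_x0
  -- The value functions telescope from the initial term to the terminal weight `Q0`.
  have htel := Finset.sum_range_sub (fun k => ∫ ω, quad (P.S k) (state P Z g k ω) ∂μ) P.N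
  rw [h0, Loop.S_horizon] at htel
  have hstep := Finset.sum_congr rfl fun k (hk : k ∈ Finset.range P.N) =>
    h.integral_step hg hu k (Finset.mem_range.1 hk)
  simp only [Finset.sum_add_distrib, Finset.sum_sub_distrib] at hstep htel ⊢
  linarith

theorem realizedCost_nonneg (h : Standing P Z μ) (g : Law n m) (ω : Ω) :
    0 ≤ realizedCost P Z g ω :=
  add_nonneg (quad_nonneg h.Q0_posSemidef _) (Finset.sum_nonneg fun _ _ =>
    add_nonneg (quad_nonneg h.Q1_posSemidef _) (quad_nonneg h.Q2_posDef.posSemidef _))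

theorem cost_eq_ofReal (h : Standing P Z μ) (hu : ∀ k < P.N, MemLp (ctrl P Z g k) 2 μ) :
    cost P Z g μ = ENNReal.ofReal (∫ ω, realizedCost P Z g ω ∂μ) :=
  (ofReal_integral_eq_lintegral_ofReal (h.integrable_realizedCost hu)
    (Filter.Eventually.of_forall (h.realizedCost_nonneg g))).symm

/-- Controls of finite cost are square integrable. -/
theorem memLp_ctrl_of_cost_lt_top (h : Standing P Z μ) (hg : g.Admissible)
    (hJ : cost P Z g μ < ∞) (k : ℕ) (hk : k < P.N) : MemLp (ctrl P Z g k) 2 μ := by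
  obtain ⟨c, hc, hle⟩ := exists_mul_norm_sq_le_quad h.Q2_posDef
  have hm := h.measurable_ctrl hg k
  rw [memLp_two_iff_integrable_sq_norm hm.aestronglyMeasurable]
  have hb : ∀ ω, c * ‖ctrl P Z g k ω‖ ^ 2 ≤ realizedCost P Z g ω := by
    intro ω
    have h1 : quad P.Q1 (state P Z g k ω) + quad P.Q2 (ctrl P Z g k ω)
        ≤ ∑ s ∈ Finset.range P.N, (quad P.Q1 (state P Z g s ω) + quad P.Q2 (ctrl P Z g s ω)) :=
      Finset.single_le_sum (f := fun s => quad P.Q1 (state P Z g s ω) + quad P.Q2 (ctrl P Z g s ω))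
        (fun s _ => add_nonneg (quad_nonneg h.Q1_posSemidef _)
          (quad_nonneg h.Q2_posDef.posSemidef _)) (Finset.mem_range.2 hk)
    have h2 := quad_nonneg h.Q0_posSemidef (state P Z g P.N ω)
    have h3 := quad_nonneg h.Q1_posSemidef (state P Z g k ω)
    rw [realizedCost]
    linarith [hle (ctrl P Z g k ω)]
  have hi : Integrable (fun ω => c * ‖ctrl P Z g k ω‖ ^ 2) μ := by
    refine ⟨by fun_prop, ?_⟩
    rw [hasFiniteIntegral_iff_ofReal (Filter.Eventually.of_forall fun ω => by positivity)]
    exact (lintegral_mono fun ω => ENNReal.ofReal_le_ofReal (hb ω)).trans_lt hJ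
  have := hi.const_mul c⁻¹
  simpa only [← mul_assoc, inv_mul_cancel₀ hc.ne', one_mul] using this

/-- The errors are common to both laws, so the control-free parts agree, and the architecture has
zero deviation. -/
theorem integral_realizedCost_controller_add (h : Standing P Z μ) (hg : g.Admissible)
    (hu : ∀ k < P.N, MemLp (ctrl P Z g k) 2 μ) :
    ∫ ω, realizedCost P Z g ω ∂μ = ∫ ω, realizedCost P Z P.controller ω ∂μ
        + ∑ k ∈ Finset.range P.N, ∫ ω, quad (P.ctrlWeight (P.S (k + 1)))
            (ctrl P Z g k ω + act (P.L k) (estimate P Z g k ω)) ∂μ := by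
  rw [h.integral_realizedCost hg hu, h.integral_realizedCost (controller_admissible P)
    fun k _ => h.memLp_ctrl_controller (by simp) k]
  simp only [ctrl_controller, neg_add_cancel, quad_zero, integral_zero, Finset.sum_const_zero,
    add_zero, err_congr P Z g P.controller]

theorem integral_deviation_nonneg (h : Standing P Z μ) (g : Law n m) (k : ℕ) :
    0 ≤ ∫ ω, quad (P.ctrlWeight (P.S (k + 1)))
      (ctrl P Z g k ω + act (P.L k) (estimate P Z g k ω)) ∂μ :=
  integral_nonneg fun _ => quad_nonneg (Loop.ctrlWeight_posDef h.posWeights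
    (Loop.S_posSemidef h.posWeights (k + 1))).posSemidef _

theorem isOptimal_controller (h : Standing P Z μ) : IsOptimal P Z P.controller μ := by
  refine ⟨controller_admissible P, fun g hg => ?_⟩
  rcases eq_or_lt_of_le (le_top : cost P Z g μ ≤ ∞) with hJ | hJ
  · rw [hJ]; exact le_top
  have hu := h.memLp_ctrl_of_cost_lt_top hg hJ
  rw [h.cost_eq_ofReal fun k _ => h.memLp_ctrl_controller (by simp) k, h.cost_eq_ofReal hu]
  refine ENNReal.ofReal_le_ofReal ?_
  rw [h.integral_realizedCost_controller_add hg hu]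
  exact le_add_of_nonneg_right (Finset.sum_nonneg fun k _ => h.integral_deviation_nonneg g k)

/-- Comparison with the architecture gives finite cost, hence square integrable controls, and makes
the sum of nonnegative deviations zero. Each deviation then vanishes almost surely because its
weight is definite. -/
theorem ctrl_ae_eq_of_isOptimal (h : Standing P Z μ) (hg : IsOptimal P Z g μ) (k : ℕ)
    (hk : k < P.N) :
    ctrl P Z g k =ᵐ[μ] fun ω => -act (P.L k) (condMean P Z g μ k ω) := by
  have hc : ∀ k < P.N, MemLp (ctrl P Z P.controller k) 2 μ := fun k _ =>
    h.memLp_ctrl_controller (by simp) k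
  have hle := hg.2 P.controller (controller_admissible P)
  have hJ : cost P Z g μ < ∞ := by
    refine hle.trans_lt ?_
    rw [h.cost_eq_ofReal hc]
    exact ENNReal.ofReal_lt_top
  have hu := h.memLp_ctrl_of_cost_lt_top hg.1 hJ
  have hui : IntegrableControls P Z g μ := fun k hk => (hu k hk).integrable (by simp)
  rw [h.cost_eq_ofReal hc, h.cost_eq_ofReal hu, ENNReal.ofReal_le_ofReal_iff
    (integral_nonneg (h.realizedCost_nonneg _)),
    h.integral_realizedCost_controller_add hg.1 hu] at hle
  have hsum := (Finset.sum_eq_zero_iff_of_nonneg fun k _ => h.integral_deviation_nonneg g k).1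
    (le_antisymm (by linarith) (Finset.sum_nonneg fun k (_ : k ∈ Finset.range P.N) =>
      h.integral_deviation_nonneg g k)) k (Finset.mem_range.2 hk)
  have hW := Loop.ctrlWeight_posDef h.posWeights (Loop.S_posSemidef h.posWeights (k + 1))
  have hz := (integral_eq_zero_iff_of_nonneg (fun ω => quad_nonneg hW.posSemidef _)
    (integrable_quad _ ((hu k hk).add
      (memLp_act (P.L k) (h.memLp_estimate (by simp) hu k hk.le))))).1 hsum
  filter_upwards [hz, h.condMean_ae_eq hg.1 hui k hk.le] with ω h1 h2
  rw [h2]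
  by_contra hne
  exact (quad_pos hW fun h0 => hne (eq_neg_of_add_eq_zero_left h0)).ne' h1

theorem certaintyEquivalence (h : Standing P Z μ) : CertaintyEquivalence P Z μ :=
  ⟨_, Loop.isDetOptimal_gain h.posWeights, ⟨_, h.isOptimal_controller⟩,
    fun _ hg => h.ctrl_ae_eq_of_isOptimal hg⟩

/-- Tower property, entry by entry: averaging the conditional covariance gives the unconditional
second moments. -/
theorem integral_trace_errorCov (h : Standing P Z μ) (hg : g.Admissible) (k : ℕ) (c : ℝ)
    {M M' : Matrix (Fin n) (Fin n) ℝ} (hM : M'.trace = c) :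
    ∫ ω, (M' + M * errorCov P Z g μ k ω).trace ∂μ = c + ∫ ω, quad M (err P Z g k ω) ∂μ := by
  have he := h.memLp_err g k (r := 2) (by simp)
  have hi : ∀ i j, Integrable (fun ω => M i j * errorCov P Z g μ k ω j i) μ := fun i j =>
    integrable_condExp.const_mul _
  simp only [trace_add, hM]
  have htr : ∀ ω, (M * errorCov P Z g μ k ω).trace
      = ∑ i, ∑ j, M i j * errorCov P Z g μ k ω j i := fun ω => rfl
  simp only [htr]
  rw [integral_add (integrable_const c) (integrable_finsetSum _ fun i _ =>
      integrable_finsetSum _ fun j _ => hi i j), integral_quad M he,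
    integral_finsetSum _ fun i _ => integrable_finsetSum _ fun j _ => hi i j]
  congr 1
  · simp
  refine Finset.sum_congr rfl fun i _ => ?_
  rw [integral_finsetSum _ fun j _ => hi i j]
  refine Finset.sum_congr rfl fun j _ => ?_
  rw [integral_const_mul]
  simp only [errorCov, Matrix.of_apply]
  rw [integral_condExp (h.infoSigma_le hg k)]
  simp only [err, PiLp.sub_apply, mul_comm]

end Standing

end DualPredictor

theorem theorem3 {Ω V C : Type*} [MeasurableSpace Ω] [MeasurableSpace V] [MeasurableSpace C]
    (μ : MeasureTheory.Measure Ω) [MeasureTheory.IsProbabilityMeasure μ] {n m : ℕ}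
    (P : DualPredictor.Loop n m V C) (Z : DualPredictor.Primitives Ω n V C)
    (h : DualPredictor.Standing P Z μ) :
    -- (i) the estimate of the observer is the MMSE estimate, whatever the control law,
    -- in particular for the controller of the architecture
    (∀ g : DualPredictor.Law n m, g.Admissible → ∀ k ≤ P.N,
      Measurable[DualPredictor.infoSigma P Z g k] (DualPredictor.estimate P Z g k) ∧
      MeasureTheory.MemLp
        (fun ω => DualPredictor.state P Z g k ω - DualPredictor.estimate P Z g k ω) 2 μ ∧
      (∀ z : Ω → DualPredictor.E n, Measurable[DualPredictor.infoSigma P Z g k] z →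
        ∫⁻ ω, ENNReal.ofReal
            (‖DualPredictor.state P Z g k ω - DualPredictor.estimate P Z g k ω‖ ^ 2) ∂μ
          ≤ ∫⁻ ω, ENNReal.ofReal (‖DualPredictor.state P Z g k ω - z ω‖ ^ 2) ∂μ) ∧
      (DualPredictor.IntegrableControls P Z g μ →
        DualPredictor.condMean P Z g μ k =ᵐ[μ] DualPredictor.estimate P Z g k)) ∧
    P.controller.Admissible ∧
    DualPredictor.IntegrableControls P Z P.controller μ ∧
    -- (ii) no dual effect
    (∀ r : ℕ, 2 ≤ r → DualPredictor.NoDualEffect P Z μ r) ∧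
    -- (iii) certainty equivalence, and optimality of the controller of the architecture
    DualPredictor.CertaintyEquivalence P Z μ ∧
    P.IsDetOptimal (fun k x => - DualPredictor.act (P.L k) x) ∧
    DualPredictor.IsOptimal P Z P.controller μ ∧
    -- (iv) the LQG cost of the architecture; the prior mean of the initial state is `∫ x0`
    MeasureTheory.Integrable (DualPredictor.realizedCost P Z P.controller) μ ∧
    ∫ ω, DualPredictor.realizedCost P Z P.controller ω ∂μ
      = DualPredictor.quad (P.S 0) (∫ ω, Z.x0 ω ∂μ) + (P.S 0 * P.R0).trace
        + ∑ k ∈ Finset.range P.N, ∫ ω,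
            (P.S (k + 1) * P.Rw
              + ((P.L k)ᵀ * (P.Q2 + P.Bᵀ * P.S (k + 1) * P.B) * P.L k)
                * DualPredictor.errorCov P Z P.controller μ k ω).trace ∂μ := by
  have hctrl : ∀ k < P.N, MemLp (DualPredictor.ctrl P Z P.controller k) 2 μ := fun k _ =>
    h.memLp_ctrl_controller (by simp) k
  refine ⟨fun g hg k hk => ⟨DualPredictor.measurable_estimate_infoSigma P Z g k,
      h.memLp_err g k (by simp), fun z hz => h.lintegral_norm_sub_estimate_le hg k hz,
      fun hu => h.condMean_ae_eq hg hu k hk⟩,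
    DualPredictor.controller_admissible P, h.integrableControls_controller,
    fun r _ => h.noDualEffect r, h.certaintyEquivalence,
    DualPredictor.Loop.isDetOptimal_gain h.posWeights, h.isOptimal_controller,
    h.integrable_realizedCost hctrl, ?_⟩
  rw [h.integral_realizedCost (DualPredictor.controller_admissible P) hctrl,
    DualPredictor.integral_of_map_eq_gaussian h.measurable_x0 h.law_x0, DualPredictor.quad_zero,
    zero_add]
  -- For the architecture the deviations vanish identically, so only the control-free part remains.
  simp only [DualPredictor.Standing.ctrl_controller, neg_add_cancel, DualPredictor.quad_zero,
    integral_zero, Finset.sum_const_zero, add_zero]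
  congr 1
  refine Finset.sum_congr rfl fun k _ => ?_
  exact (h.integral_trace_errorCov (DualPredictor.controller_admissible P) k _ rfl).symm
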